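/- Let $n\ge 1$. Let $\mathbb S(2n)$ be the space of real symmetric $2n\times 2n$ matrices with inner product $\langle A,B\rangle=\operatorname{tr}(AB)$, and $\mathbb P(2n)\subset\mathbb S(2n)$ the set of positive definite matrices. For $P\in\mathbb P(2n)$ let $d_1(P)\le\dots\le d_n(P)$ be its symplectic eigenvalues, i.e. the positive numbers such that $M^TPM=\begin{pmatrix}D&0\\0&D\end{pmatrix}$, $D=\operatorname{diag}(d_1(P),\dots,d_n(P))$, for some symplectic matrix $M$ (one with $M^TJM=J$, $J=\begin{pmatrix}0&I_n\\-I_n&0\end{pmatrix}$). Real functions on $\mathbb P(2n)$ are regarded as functions $\mathbb S(2n)\to(-\infty,\infty]$ with the value $\infty$ outside $\mathbb P(2n)$. For $f:\mathbb S(2n)\to(-\infty,\infty]$ that is finite near $A$, the directional derivative is $f'(A;H)=\lim_{t\to0^+}\frac{f(A+tH)-f(A)}{t}$, if this limit exists in $\mathbb R$; the Michel–Penot directional derivative is $$f^{\diamond}(A;H)=\sup_{X\in\mathbb S(2n)}\limsup_{t\to0^+}\frac{f(A+tX+tH)-f(A+tX)}{t},$$ and the Michel–Penot subdifferential is $\partial^{\diamond}f(A)=\{X\in\mathbb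 S(2n):\langle X,H\rangle\le f^{\diamond}(A;H)\ \ \forall H\in\mathbb S(2n)\}$. The Fenchel subdifferential of $g:\mathbb S(2n)\to(-\infty,\infty]$ at a point $A$ where $g$ is finite is $\partial g(A)=\{X\in\mathbb S(2n):\langle X,H-A\rangle\le g(H)-g(A)\ \ \forall H\in\mathbb S(2n)\}$. **Theorem.** Let $A\in\mathbb P(2n)$, let $1\le m\le n$, and let $\widehat m$ be the smallest index $j$ with $d_j(A)=d_m(A)$. Then $d_{\widehat m}$ is directionally differentiable at $A$ (that is, $d'_{\widehat m}(A;H)$ exists in $\mathbb R$ for every $H\in\mathbb S(2n)$), the function $-d'_{\widehat m}(A;\cdot)$ is sublinear (subadditive and positively homogeneous), and the Michel–Penot subdifferentials of $-d_k$ at $A$ coincide for all indices $k$ with $d_k(A)=d_m(A)$ and are given by $$\partial^{\diamond}(-d_m)(A)=\partial\bigl(-d'_{\widehat m}(A;\cdot)\bigr)(0).$$ -/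

import Mathlib

open Filter Topology

noncomputable section

namespace SymplecticSubdiff

/-- The real vector space `𝕊(2n)` of real symmetric `2n × 2n` matrices; rows and columns are indexed
by `Fin n ⊕ Fin n`, which gives the block form. -/
def SymMat (n : ℕ) : Submodule ℝ (Matrix (Fin n ⊕ Fin n) (Fin n ⊕ Fin n) ℝ) where
  carrier := {A | A.IsSymm}
  add_mem' := fun ha hb => ha.add hb
  zero_mem' := Matrix.isSymm_zero
  smul_mem' := fun c _ ha => ha.smul c

/-- The usual inner product `⟨A, B⟩ = tr (A B)` on `𝕊(2n)`. -/
def trInner {n : ℕ} (A B : SymMat n) : ℝ :=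
  ((A : Matrix (Fin n ⊕ Fin n) (Fin n ⊕ Fin n) ℝ) *
    (B : Matrix (Fin n ⊕ Fin n) (Fin n ⊕ Fin n) ℝ)).trace

/-- The set `ℙ(2n)` of positive definite matrices in `𝕊(2n)`. -/
def posDefSet (n : ℕ) : Set (SymMat n) :=
  {P | (P : Matrix (Fin n ⊕ Fin n) (Fin n ⊕ Fin n) ℝ).PosDef}

/-- `d` is a Williamson normal form of `A`: the numbers `d` are positive and in increasing order,
and `Mᵀ A M = diag(D, D)` with `D = diag(d)` for some symplectic matrix `M`. Membership in Mathlib's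
`symplecticGroup` is equivalent to `Mᵀ J M = J`, see `SymplecticGroup.mem_iff'` (for either sign
of `J`). -/
def IsWilliamson {n : ℕ} (A : SymMat n) (d : Fin n → ℝ) : Prop :=
  Monotone d ∧ (∀ j, 0 < d j) ∧
    ∃ M ∈ Matrix.symplecticGroup (Fin n) ℝ,
      M.transpose * (A : Matrix (Fin n ⊕ Fin n) (Fin n ⊕ Fin n) ℝ) * M =
        Matrix.fromBlocks (Matrix.diagonal d) 0 0 (Matrix.diagonal d)

open Classical in
/-- The symplectic eigenvalues `d_1(A) ≤ ⋯ ≤ d_n(A)`, the entries of the Williamson normal form.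
For positive definite `A` the normal form exists and is unique by Williamson's theorem; the value
`0` is only taken by matrices without a normal form. -/
def sympEig {n : ℕ} (A : SymMat n) : Fin n → ℝ :=
  if h : ∃ d, IsWilliamson A d then h.choose else 0

open Classical in
/-- A real function `g` on `ℙ(2n)`, regarded as a function `𝕊(2n) → (-∞, ∞]` with the value `∞`
outside `ℙ(2n)`. -/
def extendTop {n : ℕ} (g : SymMat n → ℝ) : SymMat n → EReal :=
  fun P => if P ∈ posDefSet n then (g P : EReal) else ⊤

/-- The map `d_m` on `ℙ(2n)`. -/
def d {n : ℕ} (m : Fin n) : SymMat n → EReal :=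
  extendTop fun P => sympEig P m

/-- The map `-d_m` on `ℙ(2n)`. -/
def negD {n : ℕ} (m : Fin n) : SymMat n → EReal :=
  extendTop fun P => -sympEig P m

open Classical in
/-- The index `m̂`: the smallest index `j` with `d_j(A) = d_m(A)`. -/
def hatIndex {n : ℕ} (A : SymMat n) (m : Fin n) : Fin n :=
  (Finset.univ.filter fun j => sympEig A j = sympEig A m).min' ⟨m, by simp⟩

/-- The one-sided directional derivative `f'(A; H)` exists in `ℝ` and equals `L`. -/
def HasDirDeriv {n : ℕ} (f : SymMat n → EReal) (A H : SymMat n) (L : ℝ) : Prop :=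
  Tendsto (fun t : ℝ => (f (A + t • H) - f A) / (t : EReal)) (𝓝[>] 0) (𝓝 (L : EReal))

/-- `f` is directionally differentiable at `A`. -/
def DirDifferentiableAt {n : ℕ} (f : SymMat n → EReal) (A : SymMat n) : Prop :=
  ∀ H, ∃ L : ℝ, HasDirDeriv f A H L

open Classical in
/-- The directional derivative `f'(A; H)`, meaningful where it exists. -/
def dirDeriv {n : ℕ} (f : SymMat n → EReal) (A H : SymMat n) : ℝ :=
  if h : ∃ L : ℝ, HasDirDeriv f A H L then h.choose else 0

/-- The Fenchel subdifferential `∂f(A)`. -/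
def fenchelSubdiff {n : ℕ} (f : SymMat n → EReal) (A : SymMat n) : Set (SymMat n) :=
  {X | ∀ H, (trInner X (H - A) : EReal) ≤ f H - f A}

/-- The Michel-Penot directional derivative `f^⋄(A; H)`. -/
def mpDeriv {n : ℕ} (f : SymMat n → EReal) (A H : SymMat n) : EReal :=
  ⨆ X : SymMat n,
    limsup (fun t : ℝ => (f (A + t • X + t • H) - f (A + t • X)) / (t : EReal)) (𝓝[>] 0)

/-- The Michel-Penot subdifferential `∂^⋄ f(A)`. -/
def mpSubdiff {n : ℕ} (f : SymMat n → EReal) (A : SymMat n) : Set (SymMat n) :=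
  {X | ∀ H, (trInner X H : EReal) ≤ mpDeriv f A H}

/-- A real function on `𝕊(2n)` is sublinear: subadditive and positively homogeneous. -/
def IsSublinear {n : ℕ} (g : SymMat n → ℝ) : Prop :=
  (∀ H K, g (H + K) ≤ g H + g K) ∧ ∀ (c : ℝ) (H : SymMat n), 0 ≤ c → g (c • H) = c * g H

end SymplecticSubdiff

end

/-! The Hermitian pencil `A - s (iJ)` turns symplectic eigenvalues into a signature count. In
complex coordinates adapted to a Williamson form (`IsFrame`) it is diagonal with entries
proportional to `d_j - s` and `d_j + s`, so for `s > 0` its negative directions count the `d_j`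
below `s`. Comparing such subspaces for `A` and `A + tH` by dimension (`card_add_card_le_of_forms`)
gives two-sided first-order bounds (`IsFrame.eventually_lower`, `IsFrame.eventually_upper`). Hence
every `d_k` has one-sided derivatives: for the indices with a common value of `d_j(A)` they are the
increasingly ordered eigenvalues of the compression of `H` to the corresponding block of `gram T H`,
a Hermitian matrix depending linearly on `H` (`IsBlockDiag.hasEigDeriv`).

The first index of the block receives the smallest eigenvalue `λ_min(H)` of the compression, a
concave function of `H`; this is the sublinearity of `-d'_m̂`. For any `k` in the block the limsup
in the Michel–Penot derivative of `-d_k` is the limit `d_k'(A;X) - d_k'(A;X+H)`. Weyl's inequality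
bounds it by `-λ_min(H)` (`HasEigDeriv.add_le`). The bound is attained by an `X` that orders an
eigenbasis of `H` with a minimal eigenvector in place `k` (`exists_hasEigDeriv_zero_add`). So the
Michel–Penot derivative is `-d'_m̂(A;·)` for each such `k` (`mpDeriv_negD`), and both
subdifferentials are cut out by the same inequalities.

Positive definite matrices must first be shown to have a Williamson form (`exists_isWilliamson`).
Its uniqueness plays no role, since the perturbation bounds hold for every frame of `A + tH`. -/

noncomputable section

namespace SymplecticSubdiff

open Matrix

/-! ### Hermitian forms: perturbation estimates and a dimension count. -/

section Forms

variable {ι κ : Type*} [Fintype ι] [Fintype κ]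

/-- The real part of the sesquilinear form `x* K x`. -/
def hermForm (K : Matrix ι ι ℂ) (x : ι → ℂ) : ℝ := (star x ⬝ᵥ K *ᵥ x).re

/-- The squared Euclidean norm of a complex vector. -/
def normSq (x : ι → ℂ) : ℝ := ∑ i, ‖x i‖ ^ 2

lemma normSq_nonneg (x : ι → ℂ) : 0 ≤ normSq x :=
  Finset.sum_nonneg fun _ _ => by positivity

lemma normSq_pos {x : ι → ℂ} (hx : x ≠ 0) : 0 < normSq x := by
  obtain ⟨i, hi⟩ := Function.ne_iff.mp hx
  have : 0 < ‖x i‖ ^ 2 := by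
    have := norm_pos_iff.mpr hi
    positivity
  exact this.trans_le
    (Finset.single_le_sum (f := fun i => ‖x i‖ ^ 2) (fun _ _ => by positivity) (Finset.mem_univ i))

lemma hermForm_add (K L : Matrix ι ι ℂ) (x : ι → ℂ) :
    hermForm (K + L) x = hermForm K x + hermForm L x := by
  simp [hermForm, add_mulVec, dotProduct_add]

lemma hermForm_smul (c : ℝ) (K : Matrix ι ι ℂ) (x : ι → ℂ) :
    hermForm ((c : ℂ) • K) x = c * hermForm K x := by
  simp [hermForm, smul_mulVec, dotProduct_smul]

lemma hermForm_neg (K : Matrix ι ι ℂ) (x : ι → ℂ) : hermForm (-K) x = -hermForm K x := by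
  simp [hermForm, neg_mulVec]

lemma hermForm_congr (K : Matrix ι ι ℂ) (S : Matrix ι κ ℂ) (x : κ → ℂ) :
    hermForm K (S *ᵥ x) = hermForm (Sᴴ * K * S) x := by
  simp only [hermForm, star_mulVec, dotProduct_mulVec, vecMul_vecMul, Matrix.mul_assoc]

lemma hermForm_eq_sum (K : Matrix ι ι ℂ) (x : ι → ℂ) :
    hermForm K x = ∑ i, ∑ j, (star (x i) * (K i j * x j)).re := by
  simp only [hermForm, dotProduct, mulVec, Finset.mul_sum, Complex.re_sum, Pi.star_apply]

lemma hermForm_diagonal [DecidableEq ι] (w : ι → ℝ) (x : ι → ℂ) :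
    hermForm (diagonal fun i => (w i : ℂ)) x = ∑ i, w i * ‖x i‖ ^ 2 := by
  simp only [hermForm, dotProduct, mulVec_diagonal, Complex.re_sum, Pi.star_apply]
  refine Finset.sum_congr rfl fun i _ => ?_
  rw [← Complex.normSq_eq_norm_sq, Complex.normSq_apply]
  simp
  ring

lemma normSq_mulVec [DecidableEq κ] (S : Matrix ι κ ℂ) (hS : Sᴴ * S = 1) (x : κ → ℂ) :
    normSq (S *ᵥ x) = normSq x := by
  classical
  have h1 := hermForm_diagonal (fun _ : ι => (1 : ℝ)) (S *ᵥ x)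
  have h2 := hermForm_diagonal (fun _ : κ => (1 : ℝ)) x
  simp only [Complex.ofReal_one, diagonal_one, one_mul] at h1 h2
  rw [hermForm_congr, Matrix.mul_one, hS, h2] at h1
  exact h1.symm

lemma exists_norm_sesq_le (K : Matrix ι ι ℂ) : ∃ C : ℝ, 0 ≤ C ∧ ∀ y z : ι → ℂ,
    ‖star y ⬝ᵥ K *ᵥ z‖ ≤ C * (√(normSq y) * √(normSq z)) := by
  classical
  refine ⟨‖toEuclideanCLM (𝕜 := ℂ) K‖, norm_nonneg _, fun y z => ?_⟩
  have h1 := norm_inner_le_norm (𝕜 := ℂ) (WithLp.toLp 2 y) (toEuclideanCLM (𝕜 := ℂ) K (WithLp.toLp 2 z))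
  have h2 := (toEuclideanCLM (𝕜 := ℂ) K).le_opNorm (WithLp.toLp 2 z)
  have hn : ∀ w : ι → ℂ, ‖WithLp.toLp 2 w‖ = √(normSq w) := fun w => EuclideanSpace.norm_eq _
  rw [EuclideanSpace.inner_eq_star_dotProduct, hn] at h1
  rw [hn z] at h2
  rw [dotProduct_comm]
  simp only [ofLp_toEuclideanCLM] at h1
  refine h1.trans ?_
  calc _ ≤ √(normSq y) * (‖toEuclideanCLM (𝕜 := ℂ) K‖ * √(normSq z)) := by gcongr
    _ = _ := by ring

/-- A perturbation `z` changes the form at `y` by little relative to `y`. -/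
lemma exists_hermForm_add_ge (K : Matrix ι ι ℂ) {ε : ℝ} (hε : 0 < ε) :
    ∃ C : ℝ, 0 ≤ C ∧ ∀ y z : ι → ℂ,
      hermForm K y - ε * normSq y - C * normSq z ≤ hermForm K (y + z) := by
  obtain ⟨C, hC, hb⟩ := exists_norm_sesq_le K
  -- `C` covers the term in `z` alone; `C ^ 2 / ε` comes from absorbing the two cross terms, `2Cpr ≤
  -- εp² + (C²/ε)r²`.
  refine ⟨C + C ^ 2 / ε, by positivity, fun y z => ?_⟩
  have e : hermForm K (y + z) = hermForm K y + (star y ⬝ᵥ K *ᵥ z).re + (star z ⬝ᵥ K *ᵥ y).re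
      + (star z ⬝ᵥ K *ᵥ z).re := by
    simp only [hermForm, star_add, mulVec_add, add_dotProduct, dotProduct_add, Complex.add_re]
    ring
  have h1 := (neg_le_abs _).trans ((Complex.abs_re_le_norm _).trans (hb y z))
  have h2 := (neg_le_abs _).trans ((Complex.abs_re_le_norm _).trans (hb z y))
  have h3 := (neg_le_abs _).trans ((Complex.abs_re_le_norm _).trans (hb z z))
  have hy := Real.sq_sqrt (normSq_nonneg y)
  have hz := Real.sq_sqrt (normSq_nonneg z)
  set p := √(normSq y)
  set r := √(normSq z)
  rw [e, ← hy, ← hz]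
  have h4 : 0 ≤ ε * (p - C / ε * r) ^ 2 := by positivity
  have h5 : ε * (p - C / ε * r) ^ 2 = ε * p ^ 2 - 2 * C * p * r + C ^ 2 / ε * r ^ 2 := by
    field_simp
    ring
  nlinarith

/-- Positivity of a small perturbation of a form that is degenerate on the coordinates in `p`. -/
lemma eventually_form_pos (K : Matrix ι ι ℂ) (p : ι → Prop) [DecidablePred p] (w e : ι → ℝ)
    {ν ε c : ℝ} (hε : 0 < ε) (hc : 0 < c) :
    ∀ᶠ t : ℝ in 𝓝[>] 0, ∀ x : ι → ℂ, x ≠ 0 →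
      (∀ i, x i ≠ 0 → (p i ∧ w i = 0 ∧ e i = ε - ν) ∨ (¬ p i ∧ c ≤ w i)) →
      (ν * normSq (fun i => if p i then x i else 0) ≤
        hermForm K (fun i => if p i then x i else 0)) →
      0 < ∑ i, (w i + t * e i) * ‖x i‖ ^ 2 + t * hermForm K x := by
  -- Half of the margin `ε` pays for the cross terms and leaves `(tε/2)|y|²` on the degenerate
  -- coordinates; the others keep `c - t(E + C) > c/2`.
  obtain ⟨C, hC, hb⟩ := exists_hermForm_add_ge K (half_pos hε)
  obtain ⟨E, hE, hEb⟩ : ∃ E : ℝ, 0 ≤ E ∧ ∀ i, -E ≤ e i :=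
    ⟨∑ i, |e i|, Finset.sum_nonneg fun _ _ => abs_nonneg _, fun i => by
      have h : |e i| ≤ ∑ i, |e i| :=
        Finset.single_le_sum (f := fun i => |e i|) (fun _ _ => abs_nonneg _) (Finset.mem_univ i)
      have := neg_abs_le (e i)
      linarith⟩
  have hlim : ∀ᶠ t : ℝ in 𝓝[>] 0, t * (E + C) < c / 2 := by
    have : Tendsto (fun t : ℝ => t * (E + C)) (𝓝[>] 0) (𝓝 0) := by
      have : Continuous fun t : ℝ => t * (E + C) := by fun_prop
      simpa using (this.tendsto 0).mono_left nhdsWithin_le_nhds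
    exact this.eventually_lt_const (half_pos hc)
  filter_upwards [hlim, self_mem_nhdsWithin] with t ht ht0 x hx hxs hK
  have ht0 : 0 < t := ht0
  set y : ι → ℂ := fun i => if p i then x i else 0 with hy
  set z : ι → ℂ := fun i => if p i then 0 else x i with hz
  have hyz : y + z = x := by
    ext i
    by_cases h : p i <;> simp [hy, hz, h]
  have hn : normSq y + normSq z = normSq x := by
    simp only [normSq, ← Finset.sum_add_distrib]
    refine Finset.sum_congr rfl fun i _ => ?_
    by_cases h : p i <;> simp [hy, hz, h]
  have hsum : t * (ε - ν) * normSq y + (c - t * E) * normSq z ≤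
      ∑ i, (w i + t * e i) * ‖x i‖ ^ 2 := by
    simp only [normSq, Finset.mul_sum, ← Finset.sum_add_distrib]
    refine Finset.sum_le_sum fun i _ => ?_
    by_cases h0 : x i = 0
    · simp [hy, hz, h0]
    rcases hxs i h0 with ⟨hp, hw, he⟩ | ⟨hp, hw⟩
    · simp [hy, hz, hp, hw, he]
    · simp only [hy, hz, hp, if_false, norm_zero, ne_eq, OfNat.ofNat_ne_zero, not_false_eq_true,
        zero_pow, mul_zero, zero_add]
      refine mul_le_mul_of_nonneg_right ?_ (by positivity)
      nlinarith [hEb i]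
  have h1 := hb y z
  rw [hyz] at h1
  have h2 := normSq_pos hx
  have h3 := normSq_nonneg y
  have h4 := normSq_nonneg z
  have h5 : t * (hermForm K y - ε / 2 * normSq y - C * normSq z) ≤ t * hermForm K x := by gcongr
  have h6 : t * (ν * normSq y) ≤ t * hermForm K y := by gcongr
  have h7 : t * (E + C) * normSq z ≤ c / 2 * normSq z := by gcongr
  have h8 : 0 < t * ε / 2 * normSq y + c / 2 * normSq z := by
    rcases h3.eq_or_lt with h | h
    · have : 0 < normSq z := by linarith
      rw [← h]
      positivity
    · have : 0 < t * ε / 2 * normSq y := by positivity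
      have : 0 ≤ c / 2 * normSq z := by positivity
      linarith
  nlinarith

/-- A form cannot be negative on one subspace and nonnegative on another one if their dimensions
add up to more than the dimension of the space. -/
lemma card_add_card_le_of_forms (Z S S' : Matrix ι ι ℂ)
    (hS' : Function.Injective S'.mulVec) (s s' : Finset ι)
    (hneg : ∀ x : ι → ℂ, (∀ i ∉ s, x i = 0) → x ≠ 0 → hermForm Z (S *ᵥ x) < 0)
    (hpos : ∀ x : ι → ℂ, (∀ i ∉ s', x i = 0) → 0 ≤ hermForm Z (S' *ᵥ x)) :
    s.card + s'.card ≤ Fintype.card ι := by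
  classical
  by_contra! hcard
  let ext0 (u : Finset ι) : (u → ℂ) →ₗ[ℂ] (ι → ℂ) :=
    { toFun := fun x i => if h : i ∈ u then x ⟨i, h⟩ else 0
      map_add' := fun x y => by ext i; by_cases h : i ∈ u <;> simp [h]
      map_smul' := fun c x => by ext i; by_cases h : i ∈ u <;> simp [h] }
  have hext : ∀ u x, ext0 u x = 0 → x = 0 := fun u x h => by
    ext i
    simpa [ext0] using congrFun h i
  have hsupp : ∀ u x, ∀ i ∉ u, ext0 u x i = 0 := fun u x i hi => by simp [ext0, hi]
  let f : ((s → ℂ) × (s' → ℂ)) →ₗ[ℂ] (ι → ℂ) :=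
    (S.mulVecLin ∘ₗ ext0 s).coprod (-(S'.mulVecLin ∘ₗ ext0 s'))
  have hker : f.ker ≠ ⊥ := by
    apply LinearMap.ker_ne_bot_of_finrank_lt
    simpa using hcard
  obtain ⟨⟨x, y⟩, hxy, hne⟩ := (Submodule.ne_bot_iff _).mp hker
  have heq : S *ᵥ ext0 s x = S' *ᵥ ext0 s' y := by
    have : S *ᵥ ext0 s x + -(S' *ᵥ ext0 s' y) = 0 := hxy
    exact add_neg_eq_zero.mp this
  -- A kernel element is a common vector of the two subspaces. If its first coordinates vanish,
  -- injectivity of `S'` kills the second; otherwise the form has contradictory signs there.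
  by_cases hx : ext0 s x = 0
  · have hy : ext0 s' y = 0 := hS' (by simp only [mulVec_zero]; rw [← heq, hx, mulVec_zero])
    exact hne (by rw [hext s x hx, hext s' y hy]; rfl)
  · have h1 := hneg _ (hsupp s x) hx
    have h2 := hpos _ (hsupp s' y)
    rw [heq] at h1
    linarith

end Forms

/-! ### Frames, the pencil, and first-order bounds for perturbed eigenvalues. -/

/-- A real matrix, regarded as a complex one. -/
def cpx {ι κ : Type*} (X : Matrix ι κ ℝ) : Matrix ι κ ℂ := X.map Complex.ofRealHom

section Frames

variable {n : ℕ}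

/-- The Hermitian pencil `A - s (iJ)`. -/
def pencil (A : SymMat n) (s : ℝ) : Matrix (Fin n ⊕ Fin n) (Fin n ⊕ Fin n) ℂ :=
  cpx A.1 - (s : ℂ) • (Complex.I • cpx (J (Fin n) ℝ))

/-- A complex basis (the columns of `T`) in which the forms of `A` and `iJ` are both diagonal. -/
structure IsFrame (A : SymMat n) (d : Fin n → ℝ)
    (T : Matrix (Fin n ⊕ Fin n) (Fin n ⊕ Fin n) ℂ) : Prop where
  form : Tᴴ * cpx A.1 * T = (2 : ℂ) • diagonal fun i => ((Sum.elim d d i : ℝ) : ℂ)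
  sympl : Tᴴ * (Complex.I • cpx (J (Fin n) ℝ)) * T =
    (2 : ℂ) • diagonal fun i => ((Sum.elim (fun _ => 1) (fun _ => -1) i : ℝ) : ℂ)

/-- Half of the form of `X` in the coordinates given by the columns of `T`. -/
def pull (T : Matrix (Fin n ⊕ Fin n) (Fin n ⊕ Fin n) ℂ) (X : SymMat n) :
    Matrix (Fin n ⊕ Fin n) (Fin n ⊕ Fin n) ℂ :=
  (1 / 2 : ℂ) • (Tᴴ * cpx X.1 * T)

/-- Half of the form of `X` on the span of the first `n` columns of `T`. -/
def gram (T : Matrix (Fin n ⊕ Fin n) (Fin n ⊕ Fin n) ℂ) (X : SymMat n) :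
    Matrix (Fin n) (Fin n) ℂ :=
  (pull T X).toBlocks₁₁

lemma cpx_add_smul (A H : SymMat n) (t : ℝ) :
    cpx (A + t • H).1 = cpx A.1 + (t : ℂ) • cpx H.1 := by
  ext i j
  simp [cpx]

lemma gram_add (T : Matrix (Fin n ⊕ Fin n) (Fin n ⊕ Fin n) ℂ) (X H : SymMat n) :
    gram T (X + H) = gram T X + gram T H := by
  have h := cpx_add_smul X H 1
  rw [one_smul, Complex.ofReal_one, one_smul] at h
  simp only [gram, pull, h, mul_add, add_mul, smul_add]
  rfl

lemma IsFrame.injective {A : SymMat n} {d : Fin n → ℝ}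
    {T : Matrix (Fin n ⊕ Fin n) (Fin n ⊕ Fin n) ℂ} (hT : IsFrame A d T) :
    Function.Injective T.mulVec := by
  intro x y hxy
  have h : (Tᴴ * (Complex.I • cpx (J (Fin n) ℝ)) * T) *ᵥ x =
      (Tᴴ * (Complex.I • cpx (J (Fin n) ℝ)) * T) *ᵥ y := by
    rw [← mulVec_mulVec, ← mulVec_mulVec y]
    exact congrArg _ hxy
  rw [hT.sympl] at h
  ext i
  have := congrFun h i
  rcases i with i | i <;> simpa [smul_mulVec, mulVec_diagonal] using this

lemma IsFrame.hermForm_pencil {A : SymMat n} {d : Fin n → ℝ}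
    {T : Matrix (Fin n ⊕ Fin n) (Fin n ⊕ Fin n) ℂ} (hT : IsFrame A d T) (H : SymMat n) (t s : ℝ)
    (x : Fin n ⊕ Fin n → ℂ) :
    hermForm (pencil (A + t • H) s) (T *ᵥ x) =
      2 * (∑ i, Sum.elim (fun j => d j - s) (fun j => d j + s) i * ‖x i‖ ^ 2
        + t * hermForm (pull T H) x) := by
  rw [hermForm_congr, pencil, cpx_add_smul]
  have h : Tᴴ * (cpx A.1 + (t : ℂ) • cpx H.1 - (s : ℂ) • (Complex.I • cpx (J (Fin n) ℝ))) * T =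
      ((2 : ℝ) : ℂ) • ((diagonal fun i =>
        ((Sum.elim (fun j => d j - s) (fun j => d j + s) i : ℝ) : ℂ)) + (t : ℂ) • pull T H) := by
    rw [Matrix.mul_sub, Matrix.sub_mul, Matrix.mul_add, Matrix.add_mul, hT.form, Matrix.mul_smul,
      Matrix.smul_mul, Matrix.mul_smul, Matrix.smul_mul, hT.sympl, pull]
    ext i j
    by_cases hij : i = j
    · subst hij
      rcases i with i | i <;> simp <;> ring
    · simp [diagonal_apply_ne _ hij]
      ring
  rw [h, hermForm_smul, hermForm_add, hermForm_diagonal, hermForm_smul]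

lemma IsFrame.hermForm_pencil_zero {A : SymMat n} {d : Fin n → ℝ}
    {T : Matrix (Fin n ⊕ Fin n) (Fin n ⊕ Fin n) ℂ} (hT : IsFrame A d T) (s : ℝ)
    (x : Fin n ⊕ Fin n → ℂ) :
    hermForm (pencil A s) (T *ᵥ x) =
      2 * ∑ i, Sum.elim (fun j => d j - s) (fun j => d j + s) i * ‖x i‖ ^ 2 := by
  simpa using hT.hermForm_pencil 0 0 s x

lemma hermForm_gram (T : Matrix (Fin n ⊕ Fin n) (Fin n ⊕ Fin n) ℂ) (X : SymMat n)
    (a : Fin n → ℂ) : hermForm (gram T X) a = hermForm (pull T X) (Sum.elim a 0) := by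
  simp [hermForm_eq_sum, gram, toBlocks₁₁]

lemma normSq_sumElim (a : Fin n → ℂ) : normSq (Sum.elim a 0 : Fin n ⊕ Fin n → ℂ) = normSq a := by
  simp [normSq]

lemma exists_pos_lower_bound {ι : Type*} [Finite ι] (f : ι → ℝ) :
    ∃ c : ℝ, 0 < c ∧ ∀ i, 0 < f i → c ≤ f i := by
  classical
  cases nonempty_fintype ι
  rcases (Finset.univ.filter fun i => 0 < f i).eq_empty_or_nonempty with h | h
  · exact ⟨1, one_pos, fun i hi => by simpa [hi] using Finset.eq_empty_iff_forall_notMem.mp h i⟩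
  · obtain ⟨i, hi, hmin⟩ := Finset.exists_min_image _ f h
    exact ⟨f i, (Finset.mem_filter.mp hi).2, fun j hj => hmin j (by simp [hj])⟩

/-- The coordinates `1, …, k` of the first half. -/
def lowerIdx (k : Fin n) : Finset (Fin n ⊕ Fin n) := (Finset.Iic k).disjSum ∅

/-- The coordinates `k, …, n` of the first half, and the second half. -/
def upperIdx (k : Fin n) : Finset (Fin n ⊕ Fin n) := (Finset.Ici k).disjSum Finset.univ

/-- The coordinate `k` of the first half belongs to both sets, so the cardinalities add up to `2n +
1`, one more than the dimension. -/
lemma card_lt_lowerIdx_add_upperIdx (k : Fin n) :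
    Fintype.card (Fin n ⊕ Fin n) < (lowerIdx k).card + (upperIdx k).card := by
  have := k.2
  simp only [lowerIdx, upperIdx, Fintype.card_sum, Fintype.card_fin, Finset.card_disjSum,
    Fin.card_Iic, Fin.card_Ici, Finset.card_empty, Finset.card_univ]
  omega

lemma IsFrame.neg_on_lowerIdx {A : SymMat n} {d : Fin n → ℝ}
    {T : Matrix (Fin n ⊕ Fin n) (Fin n ⊕ Fin n) ℂ} (hT : IsFrame A d T) (hd : Monotone d)
    {k : Fin n} {s : ℝ} (hs : d k < s) (x : Fin n ⊕ Fin n → ℂ) (hx : ∀ i ∉ lowerIdx k, x i = 0)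
    (hx0 : x ≠ 0) : hermForm (pencil A s) (T *ᵥ x) < 0 := by
  rw [hT.hermForm_pencil_zero]
  have hle : ∑ i, Sum.elim (fun j => d j - s) (fun j => d j + s) i * ‖x i‖ ^ 2 ≤
      (d k - s) * normSq x := by
    rw [normSq, Finset.mul_sum]
    refine Finset.sum_le_sum fun i _ => ?_
    by_cases hi : i ∈ lowerIdx k
    · rcases i with i | i
      · have : i ≤ k := by simpa [lowerIdx] using hi
        refine mul_le_mul_of_nonneg_right ?_ (by positivity)
        simpa using hd this
      · simp [lowerIdx] at hi
    · simp [hx i hi]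
  nlinarith [normSq_pos hx0]

lemma IsFrame.nonneg_on_upperIdx {A : SymMat n} {d : Fin n → ℝ}
    {T : Matrix (Fin n ⊕ Fin n) (Fin n ⊕ Fin n) ℂ} (hT : IsFrame A d T) (hd : Monotone d)
    (hd0 : ∀ j, 0 < d j) {k : Fin n} {s : ℝ} (hs0 : 0 ≤ s) (hs : s ≤ d k)
    (x : Fin n ⊕ Fin n → ℂ) (hx : ∀ i ∉ upperIdx k, x i = 0) :
    0 ≤ hermForm (pencil A s) (T *ᵥ x) := by
  rw [hT.hermForm_pencil_zero]
  refine mul_nonneg zero_le_two (Finset.sum_nonneg fun i _ => ?_)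
  by_cases hi : i ∈ upperIdx k
  · refine mul_nonneg ?_ (by positivity)
    rcases i with i | i
    · have : k ≤ i := by simpa [upperIdx] using hi
      simpa using hs.trans (hd this)
    · have := hd0 i
      simp only [Sum.elim_inr]
      positivity
  · simp [hx i hi]

/-- The block coordinates of a vector, as a vector of the first half. -/
lemma block_eq_sumElim (q : Fin n → Prop) [DecidablePred q]
    [DecidablePred (Sum.elim q fun _ : Fin n => False)] (x : Fin n ⊕ Fin n → ℂ) :
    (fun i => if Sum.elim q (fun _ : Fin n => False) i then x i else 0) =
      Sum.elim (fun j => if q j then x (Sum.inl j) else 0) (0 : Fin n → ℂ) := by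
  ext i
  rcases i with i | i
  · by_cases h : q i <;> simp [h]
  · simp

open Classical in
/-- Lower bound for the symplectic eigenvalues of a perturbation. -/
lemma IsFrame.eventually_lower {A : SymMat n} {d : Fin n → ℝ}
    {T : Matrix (Fin n ⊕ Fin n) (Fin n ⊕ Fin n) ℂ} (hT : IsFrame A d T) (hd : Monotone d)
    (hd0 : ∀ j, 0 < d j) (k : Fin n) (H : SymMat n) {ν ε : ℝ} (hε : 0 < ε)
    (hK : ∀ a : Fin n → ℂ, (∀ j, ¬(k ≤ j ∧ d j = d k) → a j = 0) →
      ν * normSq a ≤ hermForm (gram T H) a) :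
    ∀ᶠ t : ℝ in 𝓝[>] 0, ∀ d' T', IsFrame (A + t • H) d' T' → Monotone d' →
      d k + t * (ν - ε) ≤ d' k := by
  -- With `s = d k + t(ν - ε)` the diagonal entries `d j ∓ s` of the pencil split into these terms
  -- of order zero and the terms `± t(ε - ν)`. If `d' k < s`, the perturbed pencil would be negative
  -- on `lowerIdx k` in `T'` and nonnegative on `upperIdx k` in `T`.
  set w : Fin n ⊕ Fin n → ℝ := Sum.elim (fun j => d j - d k) (fun j => d j + d k) with hw
  obtain ⟨c, hc, hcw⟩ := exists_pos_lower_bound w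
  filter_upwards [eventually_form_pos (pull T H) (Sum.elim (fun j => d j = d k) fun _ => False)
    w (Sum.elim (fun _ => ε - ν) (fun _ => ν - ε)) (ν := ν) hε hc] with t ht d' T' hT' hd'
  by_contra! hlt
  refine absurd (card_add_card_le_of_forms (pencil (A + t • H) (d k + t * (ν - ε))) T' T
    hT.injective (lowerIdx k) (upperIdx k) (hT'.neg_on_lowerIdx hd' hlt) fun x hx => ?_)
    (card_lt_lowerIdx_add_upperIdx k).not_ge
  by_cases hx0 : x = 0
  · simp [hx0, hermForm]
  have hsupp : ∀ j, x (Sum.inl j) ≠ 0 → k ≤ j := fun j hj => by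
    by_contra hkj
    exact hj (hx _ (by simpa [upperIdx] using hkj))
  have hpos := ht x hx0 ?_ ?_
  · rw [hT.hermForm_pencil]
    refine mul_nonneg zero_le_two (hpos.le.trans (le_of_eq ?_))
    congr 1
    refine Finset.sum_congr rfl fun i _ => ?_
    rcases i with i | i <;> simp only [hw, Sum.elim_inl, Sum.elim_inr] <;> ring
  · rintro (j | j) hj
    · by_cases h : d j = d k
      · exact Or.inl ⟨h, by simp [hw, h], by simp⟩
      · refine Or.inr ⟨h, hcw _ ?_⟩
        simpa [hw] using lt_of_le_of_ne (hd (hsupp j hj)) (Ne.symm h)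
    · refine Or.inr ⟨by simp, hcw _ ?_⟩
      simpa [hw] using add_pos (hd0 j) (hd0 k)
  · rw [block_eq_sumElim, normSq_sumElim, ← hermForm_gram]
    refine hK _ fun j hj => ?_
    by_cases h : d j = d k
    · have : x (Sum.inl j) = 0 := by
        by_contra h0
        exact hj ⟨hsupp j h0, h⟩
      simp [this]
    · simp [h]

open Classical in
/-- Upper bound for the symplectic eigenvalues of a perturbation. -/
lemma IsFrame.eventually_upper {A : SymMat n} {d : Fin n → ℝ}
    {T : Matrix (Fin n ⊕ Fin n) (Fin n ⊕ Fin n) ℂ} (hT : IsFrame A d T) (hd : Monotone d)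
    (hd0 : ∀ j, 0 < d j) (k : Fin n) (H : SymMat n) {ν ε : ℝ} (hε : 0 < ε)
    (hK : ∀ a : Fin n → ℂ, (∀ j, ¬(j ≤ k ∧ d j = d k) → a j = 0) →
      hermForm (gram T H) a ≤ ν * normSq a) :
    ∀ᶠ t : ℝ in 𝓝[>] 0, ∀ d' T', IsFrame (A + t • H) d' T' → Monotone d' → (∀ j, 0 < d' j) →
      d' k ≤ d k + t * (ν + ε) := by
  -- The negated pencil is shown positive on `lowerIdx k`, with the roles of `T` and `T'` exchanged.
  -- The negative entries on the second half do no harm because the vectors vanish there.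
  set w : Fin n ⊕ Fin n → ℝ := Sum.elim (fun j => d k - d j) (fun j => -(d j + d k)) with hw
  obtain ⟨c, hc, hcw⟩ := exists_pos_lower_bound w
  have hs0 : ∀ᶠ t : ℝ in 𝓝[>] 0, 0 ≤ d k + t * (ν + ε) := by
    have h : Continuous fun t : ℝ => d k + t * (ν + ε) := by fun_prop
    have : Tendsto (fun t : ℝ => d k + t * (ν + ε)) (𝓝[>] 0) (𝓝 (d k)) := by
      simpa using (h.tendsto 0).mono_left nhdsWithin_le_nhds
    exact (this.eventually_const_lt (hd0 k)).mono fun _ => le_of_lt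
  filter_upwards [hs0, eventually_form_pos (-pull T H)
    (Sum.elim (fun j => d j = d k) fun _ => False)
    w (Sum.elim (fun _ => ε - -ν) (fun _ => -(ν + ε))) (ν := -ν) hε hc]
    with t hs0 ht d' T' hT' hd' hd0'
  by_contra! hlt
  refine absurd (card_add_card_le_of_forms (pencil (A + t • H) (d k + t * (ν + ε))) T T'
    hT'.injective (lowerIdx k) (upperIdx k) (fun x hx hx0 => ?_)
    (hT'.nonneg_on_upperIdx hd' hd0' hs0 hlt.le))
    (card_lt_lowerIdx_add_upperIdx k).not_ge
  have hinr : ∀ j, x (Sum.inr j) = 0 := fun j => hx _ (by simp [lowerIdx])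
  have hsupp : ∀ j, x (Sum.inl j) ≠ 0 → j ≤ k := fun j hj => by
    by_contra hkj
    exact hj (hx _ (by simpa [lowerIdx] using hkj))
  have hpos := ht x hx0 ?_ ?_
  · rw [hT.hermForm_pencil]
    have : ∑ i, Sum.elim (fun j => d j - (d k + t * (ν + ε))) (fun j => d j + (d k + t * (ν + ε))) i
        * ‖x i‖ ^ 2 = -∑ i, (w i + t * Sum.elim (fun _ => ε - -ν) (fun _ => -(ν + ε)) i)
        * ‖x i‖ ^ 2 := by
      rw [← Finset.sum_neg_distrib]
      refine Finset.sum_congr rfl fun i _ => ?_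
      rcases i with i | i <;> simp only [hw, Sum.elim_inl, Sum.elim_inr] <;> ring
    rw [this]
    rw [hermForm_neg] at hpos
    linarith
  · rintro (j | j) hj
    · by_cases h : d j = d k
      · exact Or.inl ⟨h, by simp [hw, h], by simp⟩
      · refine Or.inr ⟨h, hcw _ ?_⟩
        simpa [hw] using lt_of_le_of_ne (hd (hsupp j hj)) h
    · exact absurd (hinr j) hj
  · rw [block_eq_sumElim, normSq_sumElim, hermForm_neg, ← hermForm_gram, neg_mul]
    refine neg_le_neg (hK _ fun j hj => ?_)
    by_cases h : d j = d k
    · have : x (Sum.inl j) = 0 := by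
        by_contra h0
        exact hj ⟨hsupp j h0, h⟩
      simp [this]
    · simp [h]

end Frames

/-! ### Frames from Williamson forms, and their rotations. -/

section Williamson

lemma cpx_mul {ι κ μ : Type*} [Fintype κ] (X : Matrix ι κ ℝ) (Y : Matrix κ μ ℝ) :
    cpx (X * Y) = cpx X * cpx Y := Matrix.map_mul

lemma cpx_transpose {ι κ : Type*} (X : Matrix ι κ ℝ) : cpx Xᵀ = (cpx X)ᴴ := by
  ext i j
  simp [cpx]

lemma cpx_one {ι : Type*} [DecidableEq ι] : cpx (1 : Matrix ι ι ℝ) = 1 := by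
  ext i j
  by_cases h : i = j <;> simp [cpx, h, one_apply]

lemma cpx_fromBlocks {ι κ : Type*} (P : Matrix ι ι ℝ) (Q : Matrix ι κ ℝ) (R : Matrix κ ι ℝ)
    (S : Matrix κ κ ℝ) :
    cpx (fromBlocks P Q R S) = fromBlocks (cpx P) (cpx Q) (cpx R) (cpx S) :=
  fromBlocks_map _ _ _ _ _

variable {n : ℕ}

/-- The matrix with columns `e_j + i f_j` and `e_j - i f_j`. -/
def cayley (n : ℕ) : Matrix (Fin n ⊕ Fin n) (Fin n ⊕ Fin n) ℂ :=
  fromBlocks 1 1 (Complex.I • 1) (-(Complex.I • 1))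

lemma cayley_form (P Q R S : Matrix (Fin n) (Fin n) ℂ) :
    (cayley n)ᴴ * fromBlocks P Q R S * cayley n =
      fromBlocks (P + S + Complex.I • (Q - R)) (P - S - Complex.I • (Q + R))
        (P - S + Complex.I • (Q + R)) (P + S - Complex.I • (Q - R)) := by
  rw [cayley, fromBlocks_conjTranspose, fromBlocks_multiply, fromBlocks_multiply]
  have hI : ∀ (i j : Fin n), Complex.I * (Complex.I * S i j) = -S i j := fun i j => by
    rw [← mul_assoc, Complex.I_mul_I, neg_one_mul]
  congr 1 <;> ext i j <;> simp [mul_sub, hI] <;> ring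

/-- The surjectivity of `gram T` makes it possible to prescribe directions `X` by their
compressions, which is how the extremal direction for the Michel–Penot derivative is produced. -/
lemma IsWilliamson.exists_frame {A : SymMat n} {d : Fin n → ℝ} (h : IsWilliamson A d) :
    ∃ T, IsFrame A d T ∧ ∀ Y : Matrix (Fin n) (Fin n) ℂ, Y.IsHermitian →
      ∃ X : SymMat n, gram T X = Y := by
  obtain ⟨-, -, M, hM, hA⟩ := h
  have hT : ∀ X : Matrix (Fin n ⊕ Fin n) (Fin n ⊕ Fin n) ℝ,
      (cpx M * cayley n)ᴴ * cpx X * (cpx M * cayley n) =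
        (cayley n)ᴴ * cpx (Mᵀ * X * M) * cayley n := fun X => by
    simp only [cpx_mul, cpx_transpose, conjTranspose_mul, Matrix.mul_assoc]
  refine ⟨cpx M * cayley n, ⟨?_, ?_⟩, fun Y hY => ?_⟩
  · rw [hT, hA, cpx_fromBlocks, cayley_form]
    ext i j
    rcases i with i | i <;> rcases j with j | j <;> by_cases hij : i = j <;>
      simp [cpx, hij] <;> ring
  · rw [Matrix.mul_smul, Matrix.smul_mul, hT, SymplecticGroup.mem_iff'.mp hM, J, cpx_fromBlocks,
      cayley_form]
    ext i j
    rcases i with i | i <;> rcases j with j | j <;>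
      simp [cpx, diagonal_apply, one_apply] <;> split_ifs <;> simp <;> ring_nf <;> simp
  · have hdet := SymplecticGroup.symplectic_det hM
    have h1 : ∀ i j, (Y j i).re = (Y i j).re := fun i j => by
      rw [← hY.apply i j]; simp
    have h2 : ∀ i j, -(Y j i).im = (Y i j).im := fun i j => by
      rw [← hY.apply i j]; simp
    -- The usual real form of a Hermitian matrix: `cayley_form` gives it the upper left block `2Y`,
    -- and conjugation by `M⁻¹` undoes the symplectic change of basis.
    let X₀ : Matrix (Fin n ⊕ Fin n) (Fin n ⊕ Fin n) ℝ :=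
      fromBlocks (Y.map Complex.re) (Y.map Complex.im) (-Y.map Complex.im) (Y.map Complex.re)
    have hX₀ : X₀.IsSymm := by
      ext i j
      rcases i with i | i <;> rcases j with j | j <;> simp [X₀, h1 i j, ← h2 j i]
    refine ⟨⟨M⁻¹ᵀ * X₀ * M⁻¹, ?_⟩, ?_⟩
    · change (M⁻¹ᵀ * X₀ * M⁻¹)ᵀ = _
      simp only [transpose_mul, transpose_transpose, hX₀.eq, Matrix.mul_assoc]
    · have : Mᵀ * (M⁻¹ᵀ * X₀ * M⁻¹) * M = X₀ := by
        have e1 : Mᵀ * M⁻¹ᵀ = 1 := by rw [← transpose_mul, nonsing_inv_mul _ hdet, transpose_one]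
        rw [Matrix.mul_assoc, Matrix.mul_assoc _ M⁻¹ M, nonsing_inv_mul _ hdet, Matrix.mul_one,
          ← Matrix.mul_assoc, e1, Matrix.one_mul]
      simp only [gram, pull]
      rw [hT, this, cpx_fromBlocks, cayley_form]
      ext i j
      have := Complex.re_add_im (Y i j)
      simp only [toBlocks₁₁, Matrix.smul_apply, fromBlocks_apply₁₁, of_apply, cpx, map_apply,
        Matrix.add_apply, Matrix.sub_apply, Matrix.neg_apply, Complex.ofRealHom_eq_coe,
        smul_eq_mul]
      push_cast
      linear_combination this

/-- Frames are unique only up to such unitaries; this freedom allows the block of `gram T H` to be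
diagonalized without changing the forms of `A` and `iJ`. -/
lemma IsFrame.rotate {A : SymMat n} {d : Fin n → ℝ}
    {T : Matrix (Fin n ⊕ Fin n) (Fin n ⊕ Fin n) ℂ} (hT : IsFrame A d T)
    {V : Matrix (Fin n) (Fin n) ℂ} (hV : Vᴴ * V = 1)
    (hVd : Vᴴ * diagonal (fun j => (d j : ℂ)) * V = diagonal fun j => (d j : ℂ)) :
    IsFrame A d (T * fromBlocks V 0 0 1) := by
  have hdiag : ∀ u v : Fin n → ℝ, (diagonal fun i => ((Sum.elim u v i : ℝ) : ℂ)) =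
      fromBlocks (diagonal fun j => (u j : ℂ)) 0 0 (diagonal fun j => (v j : ℂ)) := fun u v => by
    rw [fromBlocks_diagonal]
    congr 1
    ext i
    rcases i with i | i <;> rfl
  have hrot : ∀ Z : Matrix (Fin n ⊕ Fin n) (Fin n ⊕ Fin n) ℂ,
      (T * fromBlocks V 0 0 1)ᴴ * Z * (T * fromBlocks V 0 0 1) =
        fromBlocks Vᴴ 0 0 1 * (Tᴴ * Z * T) * fromBlocks V 0 0 1 := fun Z => by
    simp [conjTranspose_mul, Matrix.mul_assoc, fromBlocks_conjTranspose]
  constructor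
  · rw [hrot, hT.form, Matrix.mul_smul, Matrix.smul_mul, hdiag, fromBlocks_multiply,
      fromBlocks_multiply]
    simp [hVd]
  · rw [hrot, hT.sympl, Matrix.mul_smul, Matrix.smul_mul, hdiag, fromBlocks_multiply,
      fromBlocks_multiply]
    simp [hV]

lemma gram_rotate (T : Matrix (Fin n ⊕ Fin n) (Fin n ⊕ Fin n) ℂ) (V : Matrix (Fin n) (Fin n) ℂ)
    (X : SymMat n) : gram (T * fromBlocks V 0 0 1) X = Vᴴ * gram T X * V := by
  have hrot : (T * fromBlocks V 0 0 1)ᴴ * cpx X.1 * (T * fromBlocks V 0 0 1) =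
        fromBlocks Vᴴ 0 0 1 * (Tᴴ * cpx X.1 * T) * fromBlocks V 0 0 1 := by
    simp [conjTranspose_mul, Matrix.mul_assoc, fromBlocks_conjTranspose]
  rw [gram, gram, pull, pull, hrot]
  conv_lhs => rw [← fromBlocks_toBlocks (Tᴴ * cpx X.1 * T)]
  rw [fromBlocks_multiply, fromBlocks_multiply]
  simp only [fromBlocks_smul, toBlocks_fromBlocks₁₁, Matrix.zero_mul, Matrix.mul_zero, add_zero]
  rw [show ((1 / 2 : ℂ) • (Tᴴ * cpx X.1 * T)).toBlocks₁₁ =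
    (1 / 2 : ℂ) • (Tᴴ * cpx X.1 * T).toBlocks₁₁ from rfl, Matrix.mul_smul, Matrix.smul_mul]

lemma gram_isHermitian (T : Matrix (Fin n ⊕ Fin n) (Fin n ⊕ Fin n) ℂ) (X : SymMat n) :
    (gram T X).IsHermitian := by
  have hX : (cpx X.1)ᴴ = cpx X.1 := by
    rw [← cpx_transpose, show X.1ᵀ = X.1 from X.2]
  have : (pull T X).IsHermitian := by
    simp [IsHermitian, pull, conjTranspose_mul, hX, Matrix.mul_assoc]
  ext i j
  exact congrFun (congrFun this (Sum.inl i)) (Sum.inl j)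

end Williamson

/-! ### Existence of the Williamson form and openness of positive definiteness. -/

section Existence

lemma exists_unitary_diagonal {ι : Type*} [Fintype ι] [DecidableEq ι] {Z : Matrix ι ι ℂ}
    (hZ : Z.IsHermitian) : ∃ (U : Matrix ι ι ℂ) (l : ι → ℝ), Uᴴ * U = 1 ∧ U * Uᴴ = 1 ∧
      Uᴴ * Z * U = diagonal fun i => (l i : ℂ) := by
  refine ⟨hZ.eigenvectorUnitary, hZ.eigenvalues, Unitary.coe_star_mul_self _,
    Unitary.coe_mul_star_self _, ?_⟩
  have := hZ.conjStarAlgAut_star_eigenvectorUnitary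
  rw [Unitary.conjStarAlgAut_apply] at this
  simpa [star_eq_conjTranspose, Function.comp_def] using this

/-- The real form in the basis of real and imaginary parts of the columns of `W`. -/
lemma fromCols_re_im_form {ι κ : Type*} [Fintype ι] (X : Matrix ι ι ℝ)
    (W : Matrix ι κ ℂ) (α β : Matrix κ κ ℝ)
    (h1 : Wᴴ * cpx X * W = (2 : ℂ) • (cpx α + Complex.I • cpx β)) (h2 : Wᵀ * cpx X * W = 0) :
    (fromCols (W.map Complex.re) (W.map Complex.im))ᵀ * X *
      fromCols (W.map Complex.re) (W.map Complex.im) = fromBlocks α β (-β) α := by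
  set P := W.map Complex.re with hP
  set Q := W.map Complex.im with hQ
  have hW : W = cpx P + Complex.I • cpx Q := by
    ext i j
    simp [cpx, hP, hQ, mul_comm Complex.I, Complex.re_add_im]
  have hWH : Wᴴ = cpx Pᵀ - Complex.I • cpx Qᵀ := by
    rw [hW, conjTranspose_add, conjTranspose_smul, cpx_transpose, cpx_transpose]
    simp [sub_eq_add_neg]
  have hWT : Wᵀ = cpx Pᵀ + Complex.I • cpx Qᵀ := by
    rw [hW]
    rfl
  have hadd : ∀ S T : Matrix κ κ ℝ, cpx (S + T) = cpx S + cpx T := fun S T => by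
    ext; simp [cpx]
  have hsub : ∀ S T : Matrix κ κ ℝ, cpx (S - T) = cpx S - cpx T := fun S T => by
    ext; simp [cpx]
  have e1 : Wᴴ * cpx X * W = cpx (Pᵀ * X * P + Qᵀ * X * Q) +
      Complex.I • cpx (Pᵀ * X * Q - Qᵀ * X * P) := by
    rw [hWH, hW, hadd, hsub]
    simp only [cpx_mul, Matrix.mul_add, Matrix.sub_mul, Matrix.mul_smul, Matrix.smul_mul,
      smul_sub, smul_smul, Complex.I_mul_I]
    module
  have e2 : Wᵀ * cpx X * W = cpx (Pᵀ * X * P - Qᵀ * X * Q) +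
      Complex.I • cpx (Pᵀ * X * Q + Qᵀ * X * P) := by
    rw [hWT, hW, hadd, hsub]
    simp only [cpx_mul, Matrix.mul_add, Matrix.add_mul, Matrix.mul_smul, Matrix.smul_mul,
      smul_add, smul_smul, Complex.I_mul_I]
    module
  rw [e1] at h1
  rw [e2] at h2
  have hij : ∀ i j, ((Pᵀ * X * P) i j = α i j ∧ (Pᵀ * X * Q) i j = β i j) ∧
      ((Qᵀ * X * P) i j = -β i j ∧ (Qᵀ * X * Q) i j = α i j) := fun i j => by
    have a1 := congrArg Complex.re (congrFun (congrFun h1 i) j)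
    have a2 := congrArg Complex.im (congrFun (congrFun h1 i) j)
    have a3 := congrArg Complex.re (congrFun (congrFun h2 i) j)
    have a4 := congrArg Complex.im (congrFun (congrFun h2 i) j)
    simp only [cpx, Matrix.add_apply, Matrix.sub_apply, Matrix.smul_apply, map_apply,
      Complex.ofRealHom_eq_coe, smul_eq_mul, Matrix.zero_apply, Complex.add_re, Complex.add_im,
      Complex.mul_re, Complex.mul_im, Complex.ofReal_re, Complex.ofReal_im, Complex.I_re,
      Complex.I_im, Complex.re_ofNat, Complex.im_ofNat, Complex.zero_re, Complex.zero_im]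
      at a1 a2 a3 a4
    refine ⟨⟨?_, ?_⟩, ?_, ?_⟩ <;> linarith
  rw [transpose_fromCols, fromRows_mul, fromRows_mul_fromCols]
  congr 1 <;> ext i j
  · exact (hij i j).1.1
  · exact (hij i j).1.2
  · exact (hij i j).2.1
  · exact (hij i j).2.2

/-- An invertible Hermitian matrix `Z` with `Zᵀ = -Z` has as many positive as negative
eigenvalues. -/
lemma card_pos_eigenvalues {ι : Type*} [Fintype ι] [DecidableEq ι] {Z U : Matrix ι ι ℂ} {l : ι → ℝ}
    (hZ : Zᵀ = -Z) (hU : Uᴴ * U = 1) (hl : Uᴴ * Z * U = diagonal fun i => (l i : ℂ))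
    (hl0 : ∀ i, l i ≠ 0) :
    2 * (Finset.univ.filter fun i => 0 < l i).card = Fintype.card ι := by
  have hU' : Uᵀ * Uᴴᵀ = 1 := by rw [← transpose_mul, hU, transpose_one]
  have hl' : (Uᴴᵀ)ᴴ * Z * Uᴴᵀ = diagonal fun i => ((-l i : ℝ) : ℂ) := by
    have : (Uᴴᵀ)ᴴ = Uᵀ := by ext; simp
    rw [this, ← transpose_transpose Z, hZ, ← transpose_mul, ← transpose_mul, ← Matrix.mul_assoc,
      Matrix.mul_neg, Matrix.neg_mul, hl]
    ext i j
    by_cases h : i = j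
    · simp [h]
    · simp [h, diagonal_apply_ne _ (Ne.symm h)]
  have inj : ∀ S R : Matrix ι ι ℂ, R * S = 1 → Function.Injective S.mulVec := fun S R h x y hxy => by
    have := congrArg (R *ᵥ ·) hxy
    simpa [h] using this
  have key : ∀ (S S' : Matrix ι ι ℂ) (r : ι → ℝ), Function.Injective S'.mulVec →
      Sᴴ * Z * S = (diagonal fun i => ((-r i : ℝ) : ℂ)) →
      S'ᴴ * Z * S' = (diagonal fun i => ((r i : ℝ) : ℂ)) →
      2 * (Finset.univ.filter fun i => 0 < r i).card ≤ Fintype.card ι := by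
    intro S S' r hS' h h'
    rw [two_mul]
    refine card_add_card_le_of_forms Z S S' hS' _ _ (fun x hx hx0 => ?_) fun x hx => ?_
    · rw [hermForm_congr, h, hermForm_diagonal]
      obtain ⟨i, hi⟩ := Function.ne_iff.mp hx0
      refine Finset.sum_neg' (fun j _ => ?_) ⟨i, Finset.mem_univ i, ?_⟩
      · by_cases hj : 0 < r j
        · have : 0 ≤ r j * ‖x j‖ ^ 2 := by positivity
          linarith
        · simp [hx j (by simpa using hj)]
      · have hri : 0 < r i := by
          by_contra hri
          exact hi (hx i (by simpa using hri))
        have : 0 < ‖x i‖ := norm_pos_iff.mpr hi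
        have : 0 < r i * ‖x i‖ ^ 2 := by positivity
        linarith
    · rw [hermForm_congr, h', hermForm_diagonal]
      refine Finset.sum_nonneg fun j _ => ?_
      by_cases hj : 0 < r j
      · positivity
      · simp [hx j (by simpa using hj)]
  -- The entrywise conjugate `Uᴴᵀ` diagonalizes `Z` with eigenvalues `-l`. Applied to `l` and to
  -- `-l`, `key` bounds both sign counts by half the dimension, and together they exhaust it.
  have h1 := key Uᴴᵀ U l (inj _ _ hU) hl' hl
  have h2 := key U Uᴴᵀ (fun i => -l i) (inj _ _ hU') (by simpa using hl) hl'
  have h3 : (Finset.univ.filter fun i => 0 < l i).card +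
      (Finset.univ.filter fun i => 0 < -l i).card = Fintype.card ι := by
    rw [← Finset.card_univ, ← Finset.card_filter_add_card_filter_not (s := Finset.univ)
      (fun i => 0 < l i)]
    congr 2
    ext i
    have := hl0 i
    simp only [Left.neg_pos_iff, Finset.mem_filter, Finset.mem_univ, true_and, not_lt]
    exact ⟨le_of_lt, fun h => lt_of_le_of_ne h this⟩
  omega

variable {n : ℕ}

/-- **Williamson's theorem.** -/
theorem exists_isWilliamson (A : SymMat n) (hA : A ∈ posDefSet n) : ∃ d, IsWilliamson A d := by
  obtain ⟨B, hB, hAB⟩ : ∃ B : Matrix (Fin n ⊕ Fin n) (Fin n ⊕ Fin n) ℝ, IsUnit B ∧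
      A.1 = star B * B := by
    open scoped MatrixOrder in
    exact CStarAlgebra.isStrictlyPositive_iff_eq_star_mul_self.mp
      (Matrix.isStrictlyPositive_iff_posDef.mpr hA)
  have hAB : A.1 = Bᵀ * B := hAB
  have hdet : IsUnit B.det := (isUnit_iff_isUnit_det B).mp hB
  set K := B⁻¹ᵀ * J (Fin n) ℝ * B⁻¹ with hK
  have hKT : Kᵀ = -K := by
    simp [hK, transpose_mul, J_transpose, Matrix.mul_assoc]
  have hKu : IsUnit (cpx K) := by
    have h1 : IsUnit K := by
      refine IsUnit.mul (IsUnit.mul ?_ ?_) ?_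
      · rw [isUnit_iff_isUnit_det, det_transpose]
        exact isUnit_nonsing_inv_det _ hdet
      · exact (isUnit_iff_isUnit_det _).mpr (isUnit_det_J _ _)
      · exact (isUnit_iff_isUnit_det _).mpr (isUnit_nonsing_inv_det _ hdet)
    exact h1.map (Complex.ofRealHom.mapMatrix (m := Fin n ⊕ Fin n))
  -- The eigenvalues of `Z` come in pairs `±l`; the symplectic eigenvalues are the reciprocals of
  -- the positive ones.
  set Z := Complex.I • cpx K with hZ
  have hZH : Z.IsHermitian := by
    rw [IsHermitian, hZ, conjTranspose_smul, ← cpx_transpose, hKT]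
    ext i j
    simp [cpx]
  have hZT : Zᵀ = -Z := by
    rw [hZ, transpose_smul, show (cpx K)ᵀ = cpx Kᵀ from rfl, hKT]
    ext i j
    simp [cpx]
  obtain ⟨U, l, hU, hU', hl⟩ := exists_unitary_diagonal hZH
  have hl0 : ∀ i, l i ≠ 0 := by
    have h1 : IsUnit Z := by
      rw [hZ]
      exact hKu.smul (Units.mk0 Complex.I Complex.I_ne_zero)
    have h2 : IsUnit (Uᴴ * Z * U) :=
      ((IsUnit.of_mul_eq_one _ hU).mul h1).mul (IsUnit.of_mul_eq_one _ hU')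
    rw [hl, isUnit_diagonal, Pi.isUnit_iff] at h2
    exact fun i => by simpa using (h2 i).ne_zero
  have hcard := card_pos_eigenvalues hZT hU hl hl0
  have hcard : Fintype.card {i // 0 < l i} = n := by
    rw [Fintype.card_subtype]
    simp only [Fintype.card_sum, Fintype.card_fin] at hcard
    omega
  let e₀ : Fin n ≃ {i // 0 < l i} := (Fintype.equivFinOfCardEq hcard).symm
  let e : Fin n ≃ {i // 0 < l i} := (Tuple.sort fun j => 1 / l (e₀ j)).trans e₀
  let d : Fin n → ℝ := fun j => 1 / l (e j)
  have hd0 : ∀ j, 0 < d j := fun j => one_div_pos.mpr (e j).2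
  have hmono : Monotone d := Tuple.monotone_sort fun j => 1 / l (e₀ j)
  -- This scaling gives `Wᴴ A W = 2 diag(d)` and `Wᴴ (iJ) W = 2`. For `l i < 0` the root is `0`, but
  -- `W` only keeps columns with `l i > 0`.
  let c : Fin n ⊕ Fin n → ℝ := fun i => √(2 * (1 / l i))
  have hc : ∀ j, (c (e j) : ℂ) * c (e j) = 2 * d j := fun j => by
    rw [← Complex.ofReal_mul, Real.mul_self_sqrt (by have := hd0 j; positivity)]
    simp [d]
  let F : Matrix (Fin n ⊕ Fin n) (Fin n ⊕ Fin n) ℂ := cpx B⁻¹ * U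
  let W : Matrix (Fin n ⊕ Fin n) (Fin n) ℂ :=
    (F * diagonal fun i => (c i : ℂ)).submatrix id fun j => (e j).1
  have hBA : cpx B⁻¹ᵀ * cpx A.1 * cpx B⁻¹ = 1 := by
    rw [← cpx_mul, ← cpx_mul, hAB, ← cpx_one, ← Matrix.mul_assoc, ← transpose_mul,
      mul_nonsing_inv _ hdet, transpose_one, Matrix.one_mul, mul_nonsing_inv _ hdet]
  have hFA : Fᴴ * cpx A.1 * F = 1 := by
    calc Fᴴ * cpx A.1 * F = Uᴴ * (cpx B⁻¹ᵀ * cpx A.1 * cpx B⁻¹) * U := by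
          simp only [F, conjTranspose_mul, cpx_transpose, Matrix.mul_assoc]
      _ = 1 := by rw [hBA, Matrix.mul_one, hU]
  have hFJ : Fᴴ * (Complex.I • cpx (J (Fin n) ℝ)) * F = diagonal fun i => (l i : ℂ) := by
    rw [← hl, hZ, hK]
    simp only [F, conjTranspose_mul, cpx_mul, cpx_transpose, Matrix.mul_assoc, Matrix.mul_smul,
      Matrix.smul_mul]
  have hFT : Fᵀ = Uᵀ * cpx B⁻¹ᵀ := by rw [transpose_mul]; rfl
  have hFA' : Fᵀ * cpx A.1 * F = Uᵀ * U := by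
    calc Fᵀ * cpx A.1 * F = Uᵀ * (cpx B⁻¹ᵀ * cpx A.1 * cpx B⁻¹) * U := by
          simp only [hFT, F, Matrix.mul_assoc]
      _ = _ := by rw [hBA, Matrix.mul_one]
  have hZU : Z * U = U * diagonal fun i => (l i : ℂ) := by
    rw [← hl, ← Matrix.mul_assoc, ← Matrix.mul_assoc, hU', Matrix.one_mul]
  have hFJ' : Fᵀ * (Complex.I • cpx (J (Fin n) ℝ)) * F =
      Uᵀ * U * diagonal fun i => (l i : ℂ) := by
    rw [Matrix.mul_assoc Uᵀ, ← hZU, hZ, hK]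
    simp only [hFT, F, cpx_mul, Matrix.mul_assoc, Matrix.mul_smul, Matrix.smul_mul]
  -- Since `Zᵀ = -Z`, the bilinear products satisfy `(l i + l j)(UᵀU) i j = 0`. Their vanishing
  -- makes `Wᵀ A W` and `Wᵀ J W` zero, so real and imaginary parts of `W` give a real symplectic
  -- basis.
  have hN : ∀ i j, 0 < l i → 0 < l j → (Uᵀ * U) i j = 0 := fun i j hi hj => by
    have h1 : Uᵀ * U * (diagonal fun i => (l i : ℂ)) =
        -((diagonal fun i => (l i : ℂ)) * (Uᵀ * U)) := by
      calc _ = Uᵀ * (Z * U) := by rw [hZU, Matrix.mul_assoc]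
        _ = -((Z * U)ᵀ * U) := by
          rw [transpose_mul, hZT, Matrix.mul_neg, Matrix.neg_mul, neg_neg, Matrix.mul_assoc]
        _ = _ := by rw [hZU, transpose_mul, diagonal_transpose, Matrix.mul_assoc]
    have h2 := congrFun (congrFun h1 i) j
    rw [mul_diagonal, Matrix.neg_apply, diagonal_mul] at h2
    have h3 : (Uᵀ * U) i j * ((l j + l i : ℝ) : ℂ) = 0 := by
      push_cast
      linear_combination h2
    exact (mul_eq_zero.mp h3).resolve_right (by
      have : l j + l i ≠ 0 := by positivity
      exact_mod_cast this)
  have hWH : ∀ X : Matrix (Fin n ⊕ Fin n) (Fin n ⊕ Fin n) ℂ, ∀ i j,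
      (Wᴴ * X * W) i j = c (e i) * (Fᴴ * X * F) (e i) (e j) * c (e j) := fun X i j => by
    have : (Wᴴ * X * W) i j = ((F * diagonal fun i => (c i : ℂ))ᴴ * X *
      (F * diagonal fun i => (c i : ℂ))) (e i) (e j) := rfl
    have h2 : (F * diagonal fun i => (c i : ℂ))ᴴ * X * (F * diagonal fun i => (c i : ℂ)) =
        (diagonal fun i => (c i : ℂ)) * (Fᴴ * X * F) * diagonal fun i => (c i : ℂ) := by
      rw [conjTranspose_mul, diagonal_conjTranspose]
      simp only [Matrix.mul_assoc]
      congr 2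
      ext i
      simp
    rw [this, h2, mul_diagonal, diagonal_mul]
  have hWT : ∀ X : Matrix (Fin n ⊕ Fin n) (Fin n ⊕ Fin n) ℂ, ∀ i j,
      (Wᵀ * X * W) i j = c (e i) * (Fᵀ * X * F) (e i) (e j) * c (e j) := fun X i j => by
    have : (Wᵀ * X * W) i j = ((F * diagonal fun i => (c i : ℂ))ᵀ * X *
      (F * diagonal fun i => (c i : ℂ))) (e i) (e j) := rfl
    have h2 : (F * diagonal fun i => (c i : ℂ))ᵀ * X * (F * diagonal fun i => (c i : ℂ)) =
        (diagonal fun i => (c i : ℂ)) * (Fᵀ * X * F) * diagonal fun i => (c i : ℂ) := by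
      rw [transpose_mul, diagonal_transpose]
      simp only [Matrix.mul_assoc]
    rw [this, h2, mul_diagonal, diagonal_mul]
  have heq : ∀ i j, i ≠ j → (e i).1 ≠ (e j).1 := fun i j hij h => hij (e.injective (Subtype.ext h))
  refine ⟨d, hmono, hd0, fromCols (W.map Complex.re) (W.map Complex.im), ?_, ?_⟩
  · rw [SymplecticGroup.mem_iff', fromCols_re_im_form (J (Fin n) ℝ) W 0 (-1), J]
    · simp
    · have h : Wᴴ * (Complex.I • cpx (J (Fin n) ℝ)) * W = (2 : ℂ) • 1 := by
        ext i j
        rw [hWH, hFJ]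
        by_cases hij : i = j
        · subst hij
          have h1 := hc i
          have h2 : (d i : ℂ) * l (e i) = 1 := by
            rw [← Complex.ofReal_mul, one_div_mul_cancel (hl0 _), Complex.ofReal_one]
          simp only [diagonal_apply_eq, Matrix.smul_apply, one_apply_eq, smul_eq_mul]
          linear_combination (l (e i) : ℂ) * h1 + 2 * h2
        · simp [hij, diagonal_apply_ne _ (heq i j hij)]
      have h' : Wᴴ * cpx (J (Fin n) ℝ) * W =
          -Complex.I • (Wᴴ * (Complex.I • cpx (J (Fin n) ℝ)) * W) := by
        rw [Matrix.mul_smul, Matrix.smul_mul, smul_smul]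
        simp
      rw [h', h]
      ext i j
      by_cases hij : i = j <;> simp [cpx, hij]
      ring
    · have h : Wᵀ * (Complex.I • cpx (J (Fin n) ℝ)) * W = 0 := by
        ext i j
        rw [hWT, hFJ', mul_diagonal, hN _ _ (e i).2 (e j).2]
        simp
      rw [Matrix.mul_smul, Matrix.smul_mul] at h
      exact (smul_eq_zero.mp h).resolve_left Complex.I_ne_zero
  · rw [fromCols_re_im_form A.1 W (diagonal d) 0]
    · simp
    · ext i j
      rw [hWH, hFA]
      by_cases hij : i = j
      · subst hij
        have h1 := hc i
        simp [cpx, h1]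
      · simp [cpx, hij, one_apply_ne (heq i j hij)]
    · ext i j
      rw [hWT, hFA', hN _ _ (e i).2 (e j).2]
      simp

lemma isWilliamson_sympEig {A : SymMat n} (hA : A ∈ posDefSet n) : IsWilliamson A (sympEig A) := by
  have h := exists_isWilliamson A hA
  rw [sympEig, dif_pos h]
  exact h.choose_spec

/-- Positive definiteness persists under small perturbations. -/
lemma eventually_mem_posDefSet {A : SymMat n} (hA : A ∈ posDefSet n) (H : SymMat n) :
    ∀ᶠ t : ℝ in 𝓝[>] 0, A + t • H ∈ posDefSet n := by
  have hW := isWilliamson_sympEig hA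
  obtain ⟨T, hT, -⟩ := hW.exists_frame
  obtain ⟨c, hc, hcd⟩ := exists_pos_lower_bound (sympEig A)
  -- At `s = 0` the pencil is the form of `A + tH` itself, with no degenerate coordinates.
  filter_upwards [eventually_form_pos (pull T H) (fun _ => False)
    (Sum.elim (sympEig A) (sympEig A)) 0 (ν := 0) one_pos hc] with t ht
  refine PosDef.of_dotProduct_mulVec_pos ?_ fun x hx => ?_
  · rw [IsHermitian, conjTranspose_eq_transpose_of_trivial]
    exact (A + t • H).2
  obtain ⟨y, hy⟩ := (mulVec_surjective_iff_isUnit.mpr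
    (mulVec_injective_iff_isUnit.mp hT.injective)) (fun i => (x i : ℂ))
  have hy0 : y ≠ 0 := by
    rintro rfl
    refine hx (funext fun i => ?_)
    have := congrFun hy i
    simpa using this.symm
  have h1 := ht y hy0 (fun i _ => Or.inr ⟨not_false, ?_⟩) ?_
  · have h2 := hT.hermForm_pencil H t 0 y
    have h3 : hermForm (pencil (A + t • H) 0) (T *ᵥ y) = star x ⬝ᵥ (A + t • H).1 *ᵥ x := by
      rw [hy]
      simp only [hermForm_eq_sum, pencil, dotProduct, mulVec, Finset.mul_sum]
      simp [cpx]
    rw [← h3, h2]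
    simp only [sub_zero, add_zero]
    simp only [Pi.zero_apply, mul_zero, add_zero] at h1
    exact mul_pos two_pos h1
  · rcases i with i | i <;> exact hcd i (hW.2.1 i)
  · simp [hermForm_eq_sum, normSq]

end Existence

/-! ### Diagonalizing one block by a unitary commuting with `diag(d)`. -/

section BlockDiagonalization

variable {n : ℕ}

/-- `V` is unitary, commutes with `diag(d)` and diagonalizes the block of `G` at the indices `j`
with `d j = δ`; the diagonal entries are `ν`. -/
structure IsBlockDiag (d : Fin n → ℝ) (δ : ℝ) (G V : Matrix (Fin n) (Fin n) ℂ) (ν : Fin n → ℝ) :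
    Prop where
  unitary : Vᴴ * V = 1
  comm : Vᴴ * diagonal (fun j => (d j : ℂ)) * V = diagonal fun j => (d j : ℂ)
  diag : ∀ i j, d i = δ → d j = δ → (Vᴴ * G * V) i j = diagonal (fun j => (ν j : ℂ)) i j

lemma exists_perm_monotone {β : Type*} [Fintype β] [LinearOrder β] (f : β → ℝ) :
    ∃ σ : Equiv.Perm β, Monotone (f ∘ σ) := by
  let e := Fintype.orderIsoFinOfCardEq β rfl
  refine ⟨e.symm.toEquiv.trans ((Tuple.sort (f ∘ e)).trans e.toEquiv), fun i j hij => ?_⟩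
  exact Tuple.monotone_sort (f ∘ e) (e.symm.monotone hij)

lemma exists_isBlockDiag {G : Matrix (Fin n) (Fin n) ℂ} (hG : G.IsHermitian) (d : Fin n → ℝ)
    (δ : ℝ) : ∃ V ν, IsBlockDiag d δ G V ν ∧
      ∀ i j, d i = δ → d j = δ → i ≤ j → ν i ≤ ν j := by
  classical
  let p : Fin n → Prop := fun j => d j = δ
  obtain ⟨U, l, hU, -, hl⟩ :=
    exists_unitary_diagonal (hG.submatrix (Subtype.val : {j // p j} → Fin n))
  obtain ⟨σ, hσ⟩ := exists_perm_monotone l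
  have hUσ : (U.submatrix id σ)ᴴ * U.submatrix id σ = 1 := by
    have : (U.submatrix id σ)ᴴ * U.submatrix id σ = (Uᴴ * U).submatrix σ σ := rfl
    rw [this, hU, submatrix_one_equiv]
  have hlσ : (U.submatrix id σ)ᴴ * G.submatrix Subtype.val Subtype.val * U.submatrix id σ =
      diagonal fun i => ((l (σ i) : ℝ) : ℂ) := by
    have : (U.submatrix id σ)ᴴ * G.submatrix Subtype.val Subtype.val * U.submatrix id σ =
      (Uᴴ * G.submatrix Subtype.val Subtype.val * U).submatrix σ σ := rfl
    rw [this, hl, submatrix_diagonal_equiv]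
    rfl
  set U' := U.submatrix id σ
  let e := Equiv.sumCompl p
  have hconj : ∀ X : Matrix (Fin n) (Fin n) ℂ,
      ((fromBlocks U' 0 0 1).submatrix e.symm e.symm)ᴴ * X *
        (fromBlocks U' 0 0 1).submatrix e.symm e.symm =
      (fromBlocks (U'ᴴ * (X.submatrix e e).toBlocks₁₁ * U') (U'ᴴ * (X.submatrix e e).toBlocks₁₂)
        ((X.submatrix e e).toBlocks₂₁ * U') (X.submatrix e e).toBlocks₂₂).submatrix
          e.symm e.symm := fun X => by
    have hX : X = (X.submatrix e e).submatrix e.symm e.symm := by simp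
    conv_lhs => rw [hX, ← fromBlocks_toBlocks (X.submatrix e e)]
    rw [conjTranspose_submatrix, submatrix_mul_equiv, submatrix_mul_equiv,
      fromBlocks_conjTranspose, fromBlocks_multiply, fromBlocks_multiply]
    simp
  -- The identity off the block keeps `diag(d)` fixed; the value `0` of `ν` there is a mere filler.
  refine ⟨(fromBlocks U' 0 0 1).submatrix e.symm e.symm,
    fun j => if h : p j then l (σ ⟨j, h⟩) else 0, ⟨?_, ?_, ?_⟩, ?_⟩
  · rw [conjTranspose_submatrix, submatrix_mul_equiv, fromBlocks_conjTranspose,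
      fromBlocks_multiply]
    simp [hUσ]
  · rw [hconj, submatrix_diagonal_equiv]
    have h1 : (diagonal ((fun j => (d j : ℂ)) ∘ e)).toBlocks₁₁ = (δ : ℂ) • 1 := by
      ext i j
      by_cases h : i = j
      · subst h
        simpa [toBlocks₁₁, e] using congrArg Complex.ofReal i.2
      · simp [toBlocks₁₁, h]
    have h2 : (diagonal ((fun j => (d j : ℂ)) ∘ e)).toBlocks₁₂ = 0 := by
      ext i j; simp [toBlocks₁₂]
    have h3 : (diagonal ((fun j => (d j : ℂ)) ∘ e)).toBlocks₂₁ = 0 := by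
      ext i j; simp [toBlocks₂₁]
    have hE : fromBlocks ((δ : ℂ) • 1) 0 0 (diagonal ((fun j => (d j : ℂ)) ∘ e)).toBlocks₂₂ =
        diagonal ((fun j => (d j : ℂ)) ∘ e) := by
      conv_rhs => rw [← fromBlocks_toBlocks (diagonal ((fun j => (d j : ℂ)) ∘ e)), h1, h2, h3]
    rw [h2, h3, h1, Matrix.mul_smul, Matrix.mul_one, Matrix.smul_mul, hUσ, Matrix.mul_zero,
      Matrix.zero_mul, hE, submatrix_diagonal_equiv]
    congr 1
    ext i
    simp
  · intro i j hi hj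
    rw [hconj, submatrix_apply]
    have ei : e.symm i = Sum.inl ⟨i, hi⟩ := Equiv.sumCompl_symm_apply_of_pos (p := p) hi
    have ej : e.symm j = Sum.inl ⟨j, hj⟩ := Equiv.sumCompl_symm_apply_of_pos (p := p) hj
    rw [ei, ej, fromBlocks_apply₁₁, show (G.submatrix e e).toBlocks₁₁ =
      G.submatrix Subtype.val Subtype.val from rfl, hlσ]
    by_cases h : i = j
    · subst h
      simp [p, hi]
    · simp [h]
  · intro i j hi hj hij
    simpa [p, hi, hj] using hσ (show (⟨i, hi⟩ : {j // p j}) ≤ ⟨j, hj⟩ from hij)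

lemma IsBlockDiag.swap {d : Fin n → ℝ} {δ : ℝ} {G V : Matrix (Fin n) (Fin n) ℂ} {ν : Fin n → ℝ}
    (h : IsBlockDiag d δ G V ν) {k l : Fin n} (hkl : d k = d l) :
    IsBlockDiag d δ G (V.submatrix id (Equiv.swap k l)) (ν ∘ Equiv.swap k l) := by
  have hd : ∀ j, d (Equiv.swap k l j) = d j := fun j => by
    rcases eq_or_ne j k with rfl | hk
    · simp [hkl]
    rcases eq_or_ne j l with rfl | hl
    · simp [hkl]
    · rw [Equiv.swap_apply_of_ne_of_ne hk hl]
  have hconj : ∀ X : Matrix (Fin n) (Fin n) ℂ,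
      (V.submatrix id (Equiv.swap k l))ᴴ * X * V.submatrix id (Equiv.swap k l) =
        (Vᴴ * X * V).submatrix (Equiv.swap k l) (Equiv.swap k l) := fun X => rfl
  refine ⟨?_, ?_, fun i j hi hj => ?_⟩
  · have : (V.submatrix id (Equiv.swap k l))ᴴ * V.submatrix id (Equiv.swap k l) =
      (Vᴴ * V).submatrix (Equiv.swap k l) (Equiv.swap k l) := rfl
    rw [this, h.unitary, submatrix_one_equiv]
  · rw [hconj, h.comm, submatrix_diagonal_equiv]
    congr 1
    ext j
    simp [hd j]
  · rw [hconj, submatrix_apply, h.diag _ _ ((hd i).trans hi) ((hd j).trans hj)]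
    simp [diagonal_apply]

lemma IsBlockDiag.hermForm_eq {d : Fin n → ℝ} {δ : ℝ} {G V : Matrix (Fin n) (Fin n) ℂ}
    {ν : Fin n → ℝ} (h : IsBlockDiag d δ G V ν) {a : Fin n → ℂ} (ha : ∀ j, d j ≠ δ → a j = 0) :
    hermForm (Vᴴ * G * V) a = ∑ j, ν j * ‖a j‖ ^ 2 := by
  rw [← hermForm_diagonal, hermForm_eq_sum, hermForm_eq_sum]
  refine Finset.sum_congr rfl fun i _ => Finset.sum_congr rfl fun j _ => ?_
  by_cases hi : d i = δ
  · by_cases hj : d j = δ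
    · rw [h.diag i j hi hj]
    · simp [ha j hj]
  · simp [ha i hi]

lemma IsBlockDiag.mul_conjTranspose {d : Fin n → ℝ} {δ : ℝ} {G V : Matrix (Fin n) (Fin n) ℂ}
    {ν : Fin n → ℝ} (h : IsBlockDiag d δ G V ν) : V * Vᴴ = 1 :=
  mul_eq_one_comm.mp h.unitary

/-- A matrix commuting with `diag(d)` preserves its eigenspaces. -/
lemma mulVec_supported {d : Fin n → ℝ} {δ : ℝ} {V : Matrix (Fin n) (Fin n) ℂ}
    (hV : diagonal (fun j => (d j : ℂ)) * V = V * diagonal fun j => (d j : ℂ))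
    {a : Fin n → ℂ} (ha : ∀ j, d j ≠ δ → a j = 0) (j : Fin n) (hj : d j ≠ δ) :
    (V *ᵥ a) j = 0 := by
  have h1 : diagonal (fun j => (d j : ℂ)) *ᵥ a = (δ : ℂ) • a := by
    ext i
    by_cases hi : d i = δ
    · simp [mulVec_diagonal, hi]
    · simp [mulVec_diagonal, ha i hi]
  have h2 := congrFun (congrArg (· *ᵥ a) hV) j
  simp only [← mulVec_mulVec, h1, mulVec_smul, mulVec_diagonal, Pi.smul_apply, smul_eq_mul] at h2
  have h3 : ((d j - δ : ℝ) : ℂ) * (V *ᵥ a) j = 0 := by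
    push_cast
    linear_combination h2
  refine (mul_eq_zero.mp h3).resolve_left ?_
  exact_mod_cast sub_ne_zero.mpr hj

lemma IsBlockDiag.commute {d : Fin n → ℝ} {δ : ℝ} {G V : Matrix (Fin n) (Fin n) ℂ}
    {ν : Fin n → ℝ} (h : IsBlockDiag d δ G V ν) :
    diagonal (fun j => (d j : ℂ)) * V = V * diagonal fun j => (d j : ℂ) := by
  conv_rhs => rw [← h.comm, ← Matrix.mul_assoc, ← Matrix.mul_assoc, h.mul_conjTranspose,
    Matrix.one_mul]

lemma IsBlockDiag.commute_conjTranspose {d : Fin n → ℝ} {δ : ℝ}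
    {G V : Matrix (Fin n) (Fin n) ℂ} {ν : Fin n → ℝ} (h : IsBlockDiag d δ G V ν) :
    diagonal (fun j => (d j : ℂ)) * Vᴴ = Vᴴ * diagonal fun j => (d j : ℂ) := by
  conv_lhs => rw [← h.comm, Matrix.mul_assoc, h.mul_conjTranspose, Matrix.mul_one]

/-- A form on the block is bounded below by its smallest diagonal entry in a diagonalization. -/
lemma IsBlockDiag.le_hermForm {d : Fin n → ℝ} {δ : ℝ} {G V : Matrix (Fin n) (Fin n) ℂ}
    {ν : Fin n → ℝ} (h : IsBlockDiag d δ G V ν) {c : ℝ} (hc : ∀ j, d j = δ → c ≤ ν j)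
    {a : Fin n → ℂ} (ha : ∀ j, d j ≠ δ → a j = 0) : c * normSq a ≤ hermForm G a := by
  have hb := mulVec_supported h.commute_conjTranspose ha
  have hab : a = V *ᵥ (Vᴴ *ᵥ a) := by
    rw [mulVec_mulVec, h.mul_conjTranspose, one_mulVec]
  set b := Vᴴ *ᵥ a
  rw [hab, normSq_mulVec V h.unitary, hermForm_congr, h.hermForm_eq hb, normSq, Finset.mul_sum]
  refine Finset.sum_le_sum fun j _ => ?_
  by_cases hj : d j = δ
  · exact mul_le_mul_of_nonneg_right (hc j hj) (by positivity)
  · simp [hb j hj]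

end BlockDiagonalization

/-! ### Directional derivatives, Weyl's inequality, and the Michel–Penot derivative. -/

section Derivatives

variable {n : ℕ}

/-- The symplectic eigenvalue `d_k` has the one-sided derivative `L` at `A` in direction `H`. -/
def HasEigDeriv (A : SymMat n) (k : Fin n) (H : SymMat n) (L : ℝ) : Prop :=
  Tendsto (fun t : ℝ => (sympEig (A + t • H) k - sympEig A k) / t) (𝓝[>] 0) (𝓝 L)

lemma HasEigDeriv.unique {A : SymMat n} {k : Fin n} {H : SymMat n} {L L' : ℝ}
    (h : HasEigDeriv A k H L) (h' : HasEigDeriv A k H L') : L = L' :=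
  tendsto_nhds_unique h h'

lemma eventually_le_quotient {A : SymMat n} (hA : A ∈ posDefSet n)
    {T : Matrix (Fin n ⊕ Fin n) (Fin n ⊕ Fin n) ℂ} (hT : IsFrame A (sympEig A) T) (k : Fin n)
    (H : SymMat n) {ν ε : ℝ} (hε : 0 < ε)
    (hK : ∀ a : Fin n → ℂ, (∀ j, ¬(k ≤ j ∧ sympEig A j = sympEig A k) → a j = 0) →
      ν * normSq a ≤ hermForm (gram T H) a) :
    ∀ᶠ t : ℝ in 𝓝[>] 0, ν - ε ≤ (sympEig (A + t • H) k - sympEig A k) / t := by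
  have hW := isWilliamson_sympEig hA
  filter_upwards [hT.eventually_lower hW.1 hW.2.1 k H hε hK, eventually_mem_posDefSet hA H,
    self_mem_nhdsWithin] with t ht hp ht0
  have hW' := isWilliamson_sympEig hp
  obtain ⟨T', hT', -⟩ := hW'.exists_frame
  rw [le_div_iff₀ ht0]
  linarith [ht _ T' hT' hW'.1]

lemma eventually_quotient_le {A : SymMat n} (hA : A ∈ posDefSet n)
    {T : Matrix (Fin n ⊕ Fin n) (Fin n ⊕ Fin n) ℂ} (hT : IsFrame A (sympEig A) T) (k : Fin n)
    (H : SymMat n) {ν ε : ℝ} (hε : 0 < ε)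
    (hK : ∀ a : Fin n → ℂ, (∀ j, ¬(j ≤ k ∧ sympEig A j = sympEig A k) → a j = 0) →
      hermForm (gram T H) a ≤ ν * normSq a) :
    ∀ᶠ t : ℝ in 𝓝[>] 0, (sympEig (A + t • H) k - sympEig A k) / t ≤ ν + ε := by
  have hW := isWilliamson_sympEig hA
  filter_upwards [hT.eventually_upper hW.1 hW.2.1 k H hε hK, eventually_mem_posDefSet hA H,
    self_mem_nhdsWithin] with t ht hp ht0
  have hW' := isWilliamson_sympEig hp
  obtain ⟨T', hT', -⟩ := hW'.exists_frame
  rw [div_le_iff₀ ht0]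
  linarith [ht _ T' hT' hW'.1 hW'.2.1]

/-- The derivatives are the sorted eigenvalues of the block of the form of `H`. -/
lemma IsBlockDiag.hasEigDeriv {A : SymMat n} (hA : A ∈ posDefSet n)
    {T : Matrix (Fin n ⊕ Fin n) (Fin n ⊕ Fin n) ℂ} (hT : IsFrame A (sympEig A) T) {k : Fin n}
    {H : SymMat n} {V : Matrix (Fin n) (Fin n) ℂ} {ν : Fin n → ℝ}
    (h : IsBlockDiag (sympEig A) (sympEig A k) (gram T H) V ν)
    (hle : ∀ j ≤ k, sympEig A j = sympEig A k → ν j ≤ ν k)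
    (hge : ∀ j, k ≤ j → sympEig A j = sympEig A k → ν k ≤ ν j) : HasEigDeriv A k H (ν k) := by
  -- Only the comparisons of `ν k` with the entries before and after it enter the two bounds, so the
  -- block need not be fully sorted. The construction of the extremal direction relies on this.
  have hT' := hT.rotate h.unitary h.comm
  have hform : ∀ a : Fin n → ℂ, (∀ j, sympEig A j ≠ sympEig A k → a j = 0) →
      hermForm (gram (T * fromBlocks V 0 0 1) H) a = ∑ j, ν j * ‖a j‖ ^ 2 := fun a ha => by
    rw [gram_rotate, h.hermForm_eq ha]
  refine tendsto_order.mpr ⟨fun b hb => ?_, fun b hb => ?_⟩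
  · refine (eventually_le_quotient hA hT' k H (ν := ν k) (half_pos (sub_pos.mpr hb))
      fun a ha => ?_).mono fun t ht => by linarith
    rw [hform a fun j hj => ha j fun h' => hj h'.2, normSq, Finset.mul_sum]
    refine Finset.sum_le_sum fun j _ => ?_
    by_cases hj : k ≤ j ∧ sympEig A j = sympEig A k
    · exact mul_le_mul_of_nonneg_right (hge j hj.1 hj.2) (by positivity)
    · simp [ha j hj]
  · refine (eventually_quotient_le hA hT' k H (ν := ν k) (half_pos (sub_pos.mpr hb))
      fun a ha => ?_).mono fun t ht => by linarith
    rw [hform a fun j hj => ha j fun h' => hj h'.2, normSq, Finset.mul_sum]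
    refine Finset.sum_le_sum fun j _ => ?_
    by_cases hj : j ≤ k ∧ sympEig A j = sympEig A k
    · exact mul_le_mul_of_nonneg_right (hle j hj.1 hj.2) (by positivity)
    · simp [ha j hj]

lemma exists_isBlockDiag_hasEigDeriv {A : SymMat n} (hA : A ∈ posDefSet n)
    {T : Matrix (Fin n ⊕ Fin n) (Fin n ⊕ Fin n) ℂ} (hT : IsFrame A (sympEig A) T) (δ : ℝ)
    (H : SymMat n) : ∃ V ν, IsBlockDiag (sympEig A) δ (gram T H) V ν ∧
      (∀ i j, sympEig A i = δ → sympEig A j = δ → i ≤ j → ν i ≤ ν j) ∧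
      ∀ k, sympEig A k = δ → HasEigDeriv A k H (ν k) := by
  obtain ⟨V, ν, h, hmono⟩ := exists_isBlockDiag (gram_isHermitian T H) (sympEig A) δ
  refine ⟨V, ν, h, hmono, ?_⟩
  rintro k rfl
  exact h.hasEigDeriv hA hT (fun j hj hj' => hmono j k hj' rfl hj)
    fun j hj hj' => hmono k j rfl hj' hj

lemma exists_hasEigDeriv {A : SymMat n} (hA : A ∈ posDefSet n) (k : Fin n) (H : SymMat n) :
    ∃ L, HasEigDeriv A k H L := by
  obtain ⟨T, hT, -⟩ := (isWilliamson_sympEig hA).exists_frame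
  obtain ⟨V, ν, -, -, h⟩ := exists_isBlockDiag_hasEigDeriv hA hT (sympEig A k) H
  exact ⟨_, h k rfl⟩

/-- Weyl's inequality for the derivatives of the symplectic eigenvalues in a block; `k₀` is the
first index of the block. -/
lemma HasEigDeriv.add_le {A : SymMat n} (hA : A ∈ posDefSet n) {k₀ k : Fin n}
    (hk₀ : ∀ j, sympEig A j = sympEig A k₀ → k₀ ≤ j) (hk : sympEig A k = sympEig A k₀)
    {X H : SymMat n} {c L L' : ℝ} (hc : HasEigDeriv A k₀ H c) (hL : HasEigDeriv A k X L)
    (hL' : HasEigDeriv A k (X + H) L') : L + c ≤ L' := by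
  obtain ⟨T, hT, -⟩ := (isWilliamson_sympEig hA).exists_frame
  obtain ⟨V, ν, hV, hmono, hν⟩ := exists_isBlockDiag_hasEigDeriv hA hT (sympEig A k₀) H
  obtain ⟨W, μ, hW, hmono', hμ⟩ := exists_isBlockDiag_hasEigDeriv hA hT (sympEig A k₀) X
  obtain rfl := hc.unique (hν k₀ rfl)
  obtain rfl := hL.unique (hμ k hk)
  refine le_of_forall_pos_sub_le fun ε hε => ?_
  -- In the eigenbasis of the form of `X`, on the block vectors with indices at least `k`, that form
  -- is at least `μ k` and the form of `H` at least its minimum `ν k₀` over the block.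
  refine ge_of_tendsto hL' (eventually_le_quotient hA (hT.rotate hW.unitary hW.comm) k (X + H)
    (ν := μ k + ν k₀) hε fun a ha => ?_)
  have ha' : ∀ j, sympEig A j ≠ sympEig A k₀ → a j = 0 :=
    fun j hj => ha j fun h' => hj (h'.2.trans hk)
  rw [gram_rotate, gram_add, Matrix.mul_add, Matrix.add_mul, hermForm_add, hW.hermForm_eq ha',
    add_mul]
  refine add_le_add ?_ ?_
  · rw [normSq, Finset.mul_sum]
    refine Finset.sum_le_sum fun j _ => ?_
    by_cases hj : k ≤ j ∧ sympEig A j = sympEig A k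
    · exact mul_le_mul_of_nonneg_right (hmono' k j hk (hj.2.trans hk) hj.1) (by positivity)
    · simp [ha j hj]
  · rw [← hermForm_congr, ← normSq_mulVec W hW.unitary a]
    exact hV.le_hermForm (fun j hj => hmono k₀ j rfl hj (hk₀ j hj))
      (mulVec_supported hW.commute ha')

/-- Equality case of Weyl's inequality when `k₀` is the first index: `X` shares an eigenbasis with
the compression of `H` and has widely separated eigenvalues, so adding `H` cannot move the chosen
eigenvector away from place `k`. -/
lemma exists_hasEigDeriv_zero_add {A : SymMat n} (hA : A ∈ posDefSet n) {k₀ k : Fin n}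
    (hk : sympEig A k = sympEig A k₀) {H : SymMat n} {c : ℝ} (hc : HasEigDeriv A k₀ H c) :
    ∃ X, HasEigDeriv A k X 0 ∧ HasEigDeriv A k (X + H) c := by
  obtain ⟨T, hT, hsurj⟩ := (isWilliamson_sympEig hA).exists_frame
  obtain ⟨V₀, ν₀, hV₀, hmono, hν₀⟩ := exists_isBlockDiag_hasEigDeriv hA hT (sympEig A k) H
  obtain rfl := hc.unique (hν₀ k₀ hk.symm)
  -- The swap moves the eigenvector with eigenvalue `ν₀ k₀ = c` to place `k`.
  have hV := hV₀.swap hk.symm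
  set V := V₀.submatrix id (Equiv.swap k₀ k)
  set ν := ν₀ ∘ Equiv.swap k₀ k
  have hνk : ν k = ν₀ k₀ := by simp [ν]
  obtain ⟨N, hN⟩ : ∃ N : ℝ, 0 ≤ N ∧ ∀ j, |ν j - ν k| ≤ N :=
    ⟨∑ j, |ν j - ν k|, Finset.sum_nonneg fun _ _ => abs_nonneg _, fun j =>
      Finset.single_le_sum (f := fun j => |ν j - ν k|) (fun _ _ => abs_nonneg _)
        (Finset.mem_univ j)⟩
  -- Since `N` dominates every `|ν j - ν k|`, the entries of `y` and of `y + ν` both stay correctly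
  -- ordered relative to the one at `k`.
  let y : Fin n → ℝ := fun j => if j < k then -N else if j = k then 0 else N
  have hyk : y k = 0 := by simp [y]
  have hlt : ∀ j < k, y j = -N := fun j hj => by simp [y, hj]
  have hgt : ∀ j, k < j → y j = N := fun j hj => by simp [y, hj.not_gt, hj.ne']
  have hYH : (V * diagonal (fun j => (y j : ℂ)) * Vᴴ).IsHermitian := by
    refine isHermitian_mul_mul_conjTranspose V ?_
    rw [IsHermitian, diagonal_conjTranspose]
    congr 1
    ext j
    simp
  obtain ⟨X, hX⟩ := hsurj _ hYH
  have hVX : Vᴴ * gram T X * V = diagonal fun j => (y j : ℂ) := by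
    rw [hX, Matrix.mul_assoc, Matrix.mul_assoc _ Vᴴ, hV.unitary, Matrix.mul_one,
      ← Matrix.mul_assoc, hV.unitary, Matrix.one_mul]
  have h1 : IsBlockDiag (sympEig A) (sympEig A k) (gram T X) V y :=
    ⟨hV.unitary, hV.comm, fun i j _ _ => by rw [hVX]⟩
  have h2 : IsBlockDiag (sympEig A) (sympEig A k) (gram T (X + H)) V (y + ν) :=
    ⟨hV.unitary, hV.comm, fun i j hi hj => by
      rw [gram_add, Matrix.mul_add, Matrix.add_mul, Matrix.add_apply, hVX, hV.diag i j hi hj]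
      by_cases h : i = j <;> simp [h]⟩
  refine ⟨X, ?_, ?_⟩
  · rw [← hyk]
    refine h1.hasEigDeriv hA hT (fun j hj _ => ?_) fun j hj _ => ?_
    · rcases hj.eq_or_lt with rfl | hj
      · exact le_rfl
      · rw [hyk, hlt j hj]
        linarith
    · rcases hj.eq_or_lt with rfl | hj
      · exact le_rfl
      · rw [hyk, hgt j hj]
        exact hN.1
  · have : ν₀ k₀ = (y + ν) k := by simp [hyk, hνk]
    rw [this]
    refine h2.hasEigDeriv hA hT (fun j hj _ => ?_) fun j hj _ => ?_
    · rcases hj.eq_or_lt with rfl | hj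
      · exact le_rfl
      · have := le_of_abs_le (hN.2 j)
        simp only [Pi.add_apply, hyk, hlt j hj]
        linarith
    · rcases hj.eq_or_lt with rfl | hj
      · exact le_rfl
      · have := neg_le_of_abs_le (hN.2 j)
        simp only [Pi.add_apply, hyk, hgt j hj]
        linarith

lemma HasEigDeriv.smul {A : SymMat n} {k : Fin n} {H : SymMat n} {L : ℝ}
    (h : HasEigDeriv A k H L) {c : ℝ} (hc : 0 ≤ c) : HasEigDeriv A k (c • H) (c * L) := by
  rcases hc.eq_or_lt with rfl | hc
  · simp [HasEigDeriv]
  · have h1 : Tendsto (fun t : ℝ => t * c) (𝓝[>] 0) (𝓝[>] 0) := by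
      refine tendsto_nhdsWithin_iff.mpr ⟨?_, ?_⟩
      · have : Continuous fun t : ℝ => t * c := by fun_prop
        simpa using (this.tendsto 0).mono_left nhdsWithin_le_nhds
      · filter_upwards [self_mem_nhdsWithin] with t ht
        exact mul_pos ht hc
    refine ((h.comp h1).const_mul c).congr fun t => ?_
    simp only [Function.comp_apply, mul_smul]
    field_simp

lemma eventually_extendTop {A : SymMat n} (hA : A ∈ posDefSet n) (g : SymMat n → ℝ)
    (H : SymMat n) : ∀ᶠ t : ℝ in 𝓝[>] 0, extendTop g (A + t • H) = (g (A + t • H) : EReal) := by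
  filter_upwards [eventually_mem_posDefSet hA H] with t ht
  rw [extendTop, if_pos ht]

lemma HasEigDeriv.hasDirDeriv {A : SymMat n} (hA : A ∈ posDefSet n) {k : Fin n} {H : SymMat n}
    {L : ℝ} (h : HasEigDeriv A k H L) : HasDirDeriv (d k) A H L := by
  refine ((continuous_coe_real_ereal.tendsto L).comp h).congr' ?_
  filter_upwards [eventually_extendTop hA (fun P => sympEig P k) H] with t ht
  rw [d, ht, extendTop, if_pos hA]
  simp [EReal.coe_div]

lemma HasEigDeriv.dirDeriv_eq {A : SymMat n} (hA : A ∈ posDefSet n) {k : Fin n} {H : SymMat n}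
    {L : ℝ} (h : HasEigDeriv A k H L) : dirDeriv (d k) A H = L := by
  have hex : ∃ L : ℝ, HasDirDeriv (d k) A H L := ⟨L, h.hasDirDeriv hA⟩
  rw [dirDeriv, dif_pos hex]
  exact_mod_cast tendsto_nhds_unique hex.choose_spec (h.hasDirDeriv hA)

/-- Inserting `d_k(A)` writes the quotient as a difference of two quotients based at `A`, in the
directions `X` and `X + H`, so the limsup is a limit. -/
lemma limsup_negD_quotient {A : SymMat n} (hA : A ∈ posDefSet n) {k : Fin n} {X H : SymMat n}
    {L L' : ℝ} (hL : HasEigDeriv A k X L) (hL' : HasEigDeriv A k (X + H) L') :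
    limsup (fun t : ℝ => (negD k (A + t • X + t • H) - negD k (A + t • X)) / (t : EReal))
      (𝓝[>] 0) = ((L - L' : ℝ) : EReal) := by
  refine Tendsto.limsup_eq (((continuous_coe_real_ereal.tendsto (L - L')).comp
    (hL.sub hL')).congr' ?_)
  filter_upwards [eventually_extendTop hA (fun P => -sympEig P k) X,
    eventually_extendTop hA (fun P => -sympEig P k) (X + H)] with t h1 h2
  rw [add_assoc, ← smul_add, negD, h1, h2, ← EReal.coe_sub, ← EReal.coe_div]
  simp only [Function.comp_apply]
  congr 1
  ring

/-- The Michel-Penot derivative of `-d_k` depends only on the block of `k`; `k₀` is the first index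
of the block. -/
lemma mpDeriv_negD {A : SymMat n} (hA : A ∈ posDefSet n) {k₀ k : Fin n}
    (hk₀ : ∀ j, sympEig A j = sympEig A k₀ → k₀ ≤ j) (hk : sympEig A k = sympEig A k₀)
    {H : SymMat n} {c : ℝ} (hc : HasEigDeriv A k₀ H c) :
    mpDeriv (negD k) A H = ((-c : ℝ) : EReal) := by
  refine le_antisymm (iSup_le fun X => ?_) ?_
  · obtain ⟨L, hL⟩ := exists_hasEigDeriv hA k X
    obtain ⟨L', hL'⟩ := exists_hasEigDeriv hA k (X + H)
    rw [limsup_negD_quotient hA hL hL', EReal.coe_le_coe_iff]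
    linarith [hc.add_le hA hk₀ hk hL hL']
  · obtain ⟨X, h0, h1⟩ := exists_hasEigDeriv_zero_add hA hk hc
    refine le_trans (le_of_eq ?_) (le_iSup _ X)
    rw [limsup_negD_quotient hA h0 h1, zero_sub]

end Derivatives

end SymplecticSubdiff

end

/-! ### The main theorem. -/

theorem mainTheorem5 (n : ℕ) (A : SymplecticSubdiff.SymMat n)
    (hA : A ∈ SymplecticSubdiff.posDefSet n) (m : Fin n) :
    -- the directional derivative of `d_m̂` at `A` exists in every direction
    SymplecticSubdiff.DirDifferentiableAt
      (SymplecticSubdiff.d (SymplecticSubdiff.hatIndex A m)) A ∧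
    -- its negative is sublinear
    SymplecticSubdiff.IsSublinear
      (fun H => -SymplecticSubdiff.dirDeriv
        (SymplecticSubdiff.d (SymplecticSubdiff.hatIndex A m)) A H) ∧
    -- the Michel-Penot subdifferential depends only on the value `d_m(A)`
    (∀ k : Fin n, SymplecticSubdiff.sympEig A k = SymplecticSubdiff.sympEig A m →
      SymplecticSubdiff.mpSubdiff (SymplecticSubdiff.negD k) A =
        SymplecticSubdiff.mpSubdiff (SymplecticSubdiff.negD m) A) ∧
    -- and is the Fenchel subdifferential at `0` of `-d'_m̂(A; ·)`
    SymplecticSubdiff.mpSubdiff (SymplecticSubdiff.negD m) A =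
      SymplecticSubdiff.fenchelSubdiff
        (fun H => ((-SymplecticSubdiff.dirDeriv
          (SymplecticSubdiff.d (SymplecticSubdiff.hatIndex A m)) A H : ℝ) : EReal)) 0 := by
  open SymplecticSubdiff in
  have hhat : sympEig A (hatIndex A m) = sympEig A m :=
    (Finset.mem_filter.mp (Finset.min'_mem (Finset.univ.filter fun j => sympEig A j = sympEig A m)
      ⟨m, by simp⟩)).2
  have hmin : ∀ j, sympEig A j = sympEig A (hatIndex A m) → hatIndex A m ≤ j := fun j hj =>
    Finset.min'_le _ j (by simpa using hj.trans hhat)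
  choose D hD using exists_hasEigDeriv hA (hatIndex A m)
  have hdir : ∀ H, dirDeriv (d (hatIndex A m)) A H = D H := fun H => (hD H).dirDeriv_eq hA
  have hmp : ∀ k, sympEig A k = sympEig A m → ∀ H, mpDeriv (negD k) A H = ((-D H : ℝ) : EReal) :=
    fun k hk H => mpDeriv_negD hA hmin (hk.trans hhat.symm) (hD H)
  have hsmul : ∀ (c : ℝ) H, 0 ≤ c → D (c • H) = c * D H := fun c H hc =>
    (hD (c • H)).unique ((hD H).smul hc)
  refine ⟨fun H => ⟨D H, (hD H).hasDirDeriv hA⟩, ⟨fun H K => ?_, fun c H hc => ?_⟩,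
    fun k hk => ?_, ?_⟩
  · simp only [hdir]
    -- Weyl's inequality with `k = k₀` is the superadditivity of the smallest eigenvalue.
    linarith [(hD K).add_le hA hmin rfl (hD H) (hD (H + K))]
  · simp only [hdir, hsmul c H hc, mul_neg]
  · simp only [mpSubdiff, hmp k hk, hmp m rfl]
  · have h0 : D 0 = 0 := by simpa using hsmul 0 0 le_rfl
    ext X
    simp only [mpSubdiff, fenchelSubdiff, hmp m rfl, hdir, h0, sub_zero, neg_zero,
      EReal.coe_zero, Set.mem_ofPred_eq]
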